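/- Let $d\ge 1$ be an integer, $\nu\ge 0$, $\beta>0$ and $\mu\ge\lambda:=\frac{d+1}{2}+\nu$. For a radial function $\phi:[0,\infty)\to\mathbb R$ let $$\widehat\phi(z)=\frac{z^{1-d/2}}{(2\pi)^{d/2}}\int_0^\infty u^{d/2}J_{d/2-1}(uz)\,\phi(u)\,du,\qquad z>0,$$ be its isotropic spectral density in dimension $d$, where $J_a$ is the Bessel function of the first kind. Let $\mathcal M_{\kappa,\beta}(r)=\frac{2^{1-\kappa}}{\Gamma(\kappa)}\left(\frac r\beta\right)^{\kappa}\mathcal K_\kappa\!\left(\frac r\beta\right)$ for $r>0$, with $\mathcal M_{\kappa,\beta}(0)=1$, be the Matérn correlation function, where $\kappa>0$ and $\mathcal K_\kappa$ is the modified Bessel function of the second kind. For $\delta>0$ let $\mathcal{GW}_{\nu,\mu,\delta}(r)=0$ for $r>\delta$ and, for $0\le r\le\delta$, $$\mathcal{GW}_{\nu,\mu,\delta}(r)=\frac{1}{B(2\nu,\mu+1)}\int_{r/\delta}^1u\left(u^2-(r/\delta)^2\right)^{\nu-1}(1-u)^\mu\,du\quad(\nu>0),\qquad \mathcal{GW}_{0,\mu,\delta}(r)=(1-r/\delta)^\mu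 .$$ Let $\varphi_{\nu,\mu,\beta}=\mathcal{GW}_{\nu,\mu,\delta}$ with $$\delta=\delta_{\nu,\mu,\beta}=\beta\left(\frac{\Gamma(\mu+2\nu+1)}{\Gamma(\mu)}\right)^{1/(1+2\nu)} .$$ Then, for all $z>0$, $$\widehat\varphi_{\nu,\mu,\beta}(z)=\frac{2^{-d}\pi^{-d/2}\,\Gamma(\mu+2\nu+1)\Gamma(2\nu+d)\Gamma(\nu)\,\delta^d}{\Gamma(\nu+\frac d2)\Gamma(\mu+2\nu+d+1)\Gamma(2\nu)}\;{}_1F_2\!\left(\lambda;\lambda+\tfrac\mu2,\lambda+\tfrac{\mu+1}2;-\tfrac{(z\delta)^2}{4}\right)$$ (with $\Gamma(\nu)/\Gamma(2\nu)$ read as its limit $2$ if $\nu=0$) and $$\widehat{\mathcal M}_{\nu+1/2,\beta}(z)=\frac{\Gamma(\nu+\frac{d+1}2)}{\pi^{d/2}\,\Gamma(\nu+\frac12)}\,\frac{\beta^d}{(1+\beta^2z^2)^{\nu+(d+1)/2}} .$$ Moreover the functions $z^{d-1}\widehat\varphi_{\nu,\mu,\beta}(z)$ and $z^{d-1}\widehat{\mathcal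 M}_{\nu+1/2,\beta}(z)$ are integrable on $(0,\infty)$, and $$\int_0^\infty z^{d-1}\,\widehat\varphi_{\nu,\mu,\beta}(z)\,dz=\int_0^\infty z^{d-1}\,\widehat{\mathcal M}_{\nu+1/2,\beta}(z)\,dz=\frac{\Gamma(d/2)}{2\pi^{d/2}} .$$ -/

import Mathlib

open Real Set MeasureTheory

noncomputable section

/-- Bessel function of the first kind `J_a` of real order `a`, for arguments `x > 0`. -/
def besselJ (a x : ℝ) : ℝ :=
  ∑' k : ℕ, (-1) ^ k / ((Nat.factorial k : ℝ) * Gamma (k + a + 1)) * (x / 2) ^ (2 * (k : ℝ) + a)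

/-- Modified Bessel function of the second kind `K_a` of real order `a`, for arguments `x > 0`. -/
def besselK (a x : ℝ) : ℝ :=
  ∫ t in Ioi (0 : ℝ), exp (-x * cosh t) * cosh (a * t)

/-- The hypergeometric function `₁F₂(a; b, c; x)`. -/
def hypergeometric1F2 (a b c x : ℝ) : ℝ :=
  ∑' k : ℕ, (ascPochhammer ℝ k).eval a /
    ((ascPochhammer ℝ k).eval b * (ascPochhammer ℝ k).eval c) * (x ^ k / (Nat.factorial k : ℝ))

/-- The isotropic spectral density in dimension `d` of the radial function `φ`, at `z > 0`:
the Hankel form of `(2π)^(-d) ∫ φ(‖x‖) exp(-i⟨x, ξ⟩) dx` over `ℝ^d` at any `ξ` with `‖ξ‖ = z`. -/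
def spectralDensity (d : ℕ) (φ : ℝ → ℝ) (z : ℝ) : ℝ :=
  z ^ (1 - (d : ℝ) / 2) / (2 * π) ^ ((d : ℝ) / 2) *
    ∫ u in Ioi (0 : ℝ), u ^ ((d : ℝ) / 2) * besselJ ((d : ℝ) / 2 - 1) (u * z) * φ u

/-- The Matérn correlation function (with its value `1` at the origin), for `r ≥ 0`. -/
def matern (ν β r : ℝ) : ℝ :=
  if r = 0 then 1
  else 2 ^ (1 - ν) / Gamma ν * (r / β) ^ ν * besselK ν (r / β)

/-- The closed form of the isotropic spectral density of the Matérn correlation function. -/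
def maternSpectral (d : ℕ) (ν β z : ℝ) : ℝ :=
  Gamma (ν + d / 2) / (π ^ ((d : ℝ) / 2) * Gamma ν) *
    (β ^ d / (1 + β ^ 2 * z ^ 2) ^ (ν + (d : ℝ) / 2))

/-- The generalized Wendland correlation function, for `r ≥ 0`; it is the Askey function if
`ν = 0`. -/
def generalizedWendland (ν μ β r : ℝ) : ℝ :=
  if r ≤ β then
    if ν = 0 then (1 - r / β) ^ μ
    else 1 / ProbabilityTheory.beta (2 * ν) (μ + 1) *
      ∫ u in (r / β)..1, u * (u ^ 2 - (r / β) ^ 2) ^ (ν - 1) * (1 - u) ^ μ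
  else 0

/-- `λ(d, ν) = (d + 1) / 2 + ν`. -/
def wendlandLambda (d : ℕ) (ν : ℝ) : ℝ := ((d : ℝ) + 1) / 2 + ν

/-- The ratio `Γ(ν) / Γ(2ν)`, with its limit `2` at `ν = 0`. -/
def gammaRatio (ν : ℝ) : ℝ := if ν = 0 then 2 else Gamma ν / Gamma (2 * ν)

/-- The closed form of the isotropic spectral density of the generalized Wendland correlation
function. -/
def generalizedWendlandSpectral (d : ℕ) (ν μ β z : ℝ) : ℝ :=
  2 ^ (-(d : ℝ)) * π ^ (-(d : ℝ) / 2) * Gamma (μ + 2 * ν + 1) * Gamma (2 * ν + d) * gammaRatio ν /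
      (Gamma (ν + d / 2) * Gamma (μ + 2 * ν + d + 1)) * β ^ d *
    hypergeometric1F2 (wendlandLambda d ν) (wendlandLambda d ν + μ / 2)
      (wendlandLambda d ν + (μ + 1) / 2) (-(z * β) ^ 2 / 4)

/-- The compact support parameter `δ_{ν,μ,β}`. -/
def wendlandDelta (ν μ β : ℝ) : ℝ :=
  β * (Gamma (μ + 2 * ν + 1) / Gamma μ) ^ (1 / (1 + 2 * ν))

/-- The reparametrized generalized Wendland correlation function `φ_{ν,μ,β}`. -/
def reparamWendland (ν μ β r : ℝ) : ℝ :=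
  generalizedWendland ν μ (wendlandDelta ν μ β) r

end

/-! Put `a = d/2 - 1` and replace `J_a` by the entire, even function `besselSeries a`. The spectral
density becomes a constant times the integral of `u ^ (d - 1) * besselSeries a (u * z) * φ u`, and
for `d ≥ 1` this kernel is bounded.

Closed forms. The Wendland function is a Beta-type mixture, so Tonelli and two Beta integrals give
all its Mellin moments; integrating the Bessel series term by term and applying the duplication
formula for Gamma yields the `₁F₂` series (`spectralDensity_wendlandProfile`). The Matérn function
is a Gamma mixture of Gaussians; the Hankel transform of a Gaussian is a Gaussian, and Fubini leaves
one Gamma integral (`spectralDensity_matern`).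

Common value of the integrals. Up to a constant, the integral of `z ^ (d - 1)` times the density is
Fourier inversion at the origin, where both correlations equal 1. `integral_pow_mul_spectralDensity`
proves it by Gaussian regularization for any measurable `φ` bounded by 1, tending to 1 at the
origin, with integrable radial function and integrable density.

Integrability. For Matérn it is read off the closed form. For Wendland it is the hard point, and it
is where `μ ≥ λ` enters: the `₁F₂` must decay faster than `z ^ (-d)`. Up to a power of the argument
it is `laplaceSeries λ (2λ + μ)`, whose Laplace transform is formally `s ^ (-μ) * (1 + s ^ 2) ^
(-λ)`. Splitting off factors `1 / (s * (1 + s ^ 2))`, the transform of `1 - cos`, lowers `λ` and `μ`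
by one together until `0 < λ ≤ 1`. There the function is a fractional integral either of `1 - cos`
or of a Bessel function of order in `(-1/2, 1/2)` with known decay. Convolving back gives growth at
most `x ^ (μ - ε)` with `ε > 0` (`exists_abs_laplaceSeries_le`), which is the required decay. The
transforms only guide the argument; the convolution identities are proved on power series. -/

/-! ### Pochhammer symbols and Gamma quotients. -/

theorem ascPochhammer_eval_mul_Gamma {x : ℝ} (hx : 0 < x) (k : ℕ) :
    (ascPochhammer ℝ k).eval x * Gamma x = Gamma (x + k) := by
  induction k with
  | zero => simp
  | succ k ih =>
    rw [ascPochhammer_succ_eval, mul_right_comm, ih, Nat.cast_succ, ← add_assoc,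
      Real.Gamma_add_one (by positivity)]
    ring

/-- Duplication formula in Pochhammer form: the `2 * k` factors from `x` to `x + 2 * k - 1` are
split by parity. -/
theorem Gamma_add_two_mul {x : ℝ} (hx : 0 < x) (k : ℕ) :
    Gamma (x + 2 * k) =
      4 ^ k * ((ascPochhammer ℝ k).eval (x / 2) * (ascPochhammer ℝ k).eval ((x + 1) / 2)) *
        Gamma x := by
  induction k with
  | zero => simp
  | succ k ih =>
    have h : x + 2 * ((k + 1 : ℕ) : ℝ) = x + 2 * k + 1 + 1 := by push_cast; ring
    rw [h, Real.Gamma_add_one (by positivity), Real.Gamma_add_one (by positivity), ih,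
      ascPochhammer_succ_eval, ascPochhammer_succ_eval]
    ring

/-- A lower bound uniform in `k`, so that Pochhammer symbols and Gamma values in denominators can be
dropped and the series compared with the exponential. -/
theorem min_one_le_ascPochhammer_eval {x : ℝ} (hx : 0 < x) (k : ℕ) :
    min 1 x ≤ (ascPochhammer ℝ k).eval x := by
  rcases k with _ | k
  · simp
  · have h : ∀ k : ℕ, 1 ≤ (ascPochhammer ℝ k).eval (x + 1) := by
      intro k
      induction k with
      | zero => simp
      | succ k ih =>
        rw [ascPochhammer_succ_eval]
        have : (0 : ℝ) ≤ k := by positivity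
        nlinarith
    have h2 : (ascPochhammer ℝ (k + 1)).eval x = x * (ascPochhammer ℝ k).eval (x + 1) := by
      rw [ascPochhammer_succ_left]; simp [Polynomial.eval_comp]
    rw [h2]
    exact (min_le_right _ _).trans (le_mul_of_one_le_right hx.le (h k))

/-! ### The normalized Bessel series and termwise integration. -/

/-- The entire function `(x / 2) ^ (-a) * besselJ a x`. -/
noncomputable def besselSeries (a x : ℝ) : ℝ :=
  ∑' k : ℕ, (-1) ^ k / ((Nat.factorial k : ℝ) * Gamma (k + a + 1)) * (x / 2) ^ (2 * k)

theorem summable_pow_div_factorial_mul_Gamma {a : ℝ} (ha : -1 < a) (y : ℝ) :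
    Summable fun k : ℕ => y ^ k / ((Nat.factorial k : ℝ) * Gamma (k + a + 1)) := by
  have ha1 : 0 < a + 1 := by linarith
  have hG : 0 < Gamma (a + 1) := Real.Gamma_pos_of_pos ha1
  have hm : 0 < min 1 (a + 1) := lt_min one_pos ha1
  refine Summable.of_norm_bounded
    (g := fun k : ℕ => (min 1 (a + 1) * Gamma (a + 1))⁻¹ * (|y| ^ k / (Nat.factorial k : ℝ)))
    ((Real.summable_pow_div_factorial |y|).mul_left _) fun k => ?_
  have hk : Gamma (k + a + 1) = (ascPochhammer ℝ k).eval (a + 1) * Gamma (a + 1) := by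
    rw [ascPochhammer_eval_mul_Gamma ha1]; congr 1; ring
  have hlow : min 1 (a + 1) * Gamma (a + 1) ≤ Gamma (k + a + 1) := by
    rw [hk]; gcongr; exact min_one_le_ascPochhammer_eval ha1 k
  have hpos : 0 < min 1 (a + 1) * Gamma (a + 1) := by positivity
  have hG2 : 0 < Gamma (k + a + 1) := hpos.trans_le hlow
  rw [norm_div, norm_pow, norm_eq_abs, norm_eq_abs,
    abs_of_pos (show 0 < (Nat.factorial k : ℝ) * Gamma (k + a + 1) by positivity)]
  calc |y| ^ k / ((Nat.factorial k : ℝ) * Gamma (k + a + 1))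
      = (Gamma (k + a + 1))⁻¹ * (|y| ^ k / (Nat.factorial k : ℝ)) := by field_simp
    _ ≤ _ := by gcongr

theorem summable_besselSeries {a : ℝ} (ha : -1 < a) (x : ℝ) :
    Summable fun k : ℕ =>
      (-1) ^ k / ((Nat.factorial k : ℝ) * Gamma (k + a + 1)) * (x / 2) ^ (2 * k) := by
  convert summable_pow_div_factorial_mul_Gamma ha (-(x / 2) ^ 2) using 2 with k
  rw [neg_pow ((x / 2) ^ 2), pow_mul, mul_div_right_comm]

theorem measurable_besselSeries {a : ℝ} (ha : -1 < a) : Measurable (besselSeries a) := by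
  refine measurable_of_tendsto_metrizable (f := fun (n : ℕ) x => ∑ k ∈ Finset.range n,
    (-1) ^ k / ((Nat.factorial k : ℝ) * Gamma (k + a + 1)) * (x / 2) ^ (2 * k)) ?_ ?_
  · intro n; fun_prop
  · rw [tendsto_pi_nhds]
    exact fun x => (summable_besselSeries ha x).hasSum.tendsto_sum_nat

theorem besselJ_eq_rpow_mul_besselSeries (a : ℝ) {x : ℝ} (hx : 0 < x) :
    besselJ a x = (x / 2) ^ a * besselSeries a x := by
  rw [besselJ, besselSeries, ← tsum_mul_left]
  refine tsum_congr fun k => ?_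
  rw [rpow_add (by positivity), show (2 * (k : ℝ)) = ((2 * k : ℕ) : ℝ) by push_cast; ring,
    rpow_natCast]
  ring

/-- Legendre's duplication formula turns `k! * Γ(k + 1/2)` into a multiple of `(2k)!`. This is the
kernel in dimension one and the starting point of Poisson's integral. -/
theorem besselSeries_neg_half (x : ℝ) : besselSeries (-1 / 2) x = cos x / √π := by
  rw [besselSeries, Real.cos_eq_tsum, ← tsum_div_const]
  refine tsum_congr fun k => ?_
  have h := Real.Gamma_mul_Gamma_add_half (k + 1 / 2 : ℝ)
  have h1 : (2 * (k + 1 / 2 : ℝ)) = ((2 * k : ℕ) : ℝ) + 1 := by push_cast; ring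
  have h2 : (k + 1 / 2 + 1 / 2 : ℝ) = (k : ℝ) + 1 := by ring
  have h3 : (1 : ℝ) - (((2 * k : ℕ) : ℝ) + 1) = -((2 * k : ℕ) : ℝ) := by ring
  rw [h1, h2, h3, Real.Gamma_nat_eq_factorial, Real.Gamma_nat_eq_factorial,
    rpow_neg (by norm_num), rpow_natCast] at h
  have h4 : (k : ℝ) + -1 / 2 + 1 = k + 1 / 2 := by ring
  rw [h4, mul_comm, mul_comm (Nat.factorial k : ℝ), h, div_pow]
  have : (0 : ℝ) < √π := by positivity
  field_simp

/-- Termwise integration of `besselSeries` against a nonnegative function all of whose moments are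
under control. -/
theorem hasSum_integral_rpow_mul_besselSeries {a : ℝ} (ha : -1 < a) {f : ℝ → ℝ}
    (hf : ∀ u, 0 < u → 0 ≤ f u) (z : ℝ)
    (hint : ∀ k : ℕ, IntegrableOn (fun u => u ^ (2 * a + 1 + 2 * k) * f u) (Ioi 0))
    (hsum : Summable fun k : ℕ => ((z / 2) ^ 2) ^ k / ((Nat.factorial k : ℝ) * Gamma (k + a + 1)) *
      ∫ u in Ioi (0 : ℝ), u ^ (2 * a + 1 + 2 * k) * f u) :
    HasSum (fun k : ℕ => (-(z / 2) ^ 2) ^ k / ((Nat.factorial k : ℝ) * Gamma (k + a + 1)) *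
        ∫ u in Ioi (0 : ℝ), u ^ (2 * a + 1 + 2 * k) * f u)
      (∫ u in Ioi (0 : ℝ), u ^ (2 * a + 1) * besselSeries a (u * z) * f u) := by
  have hG : ∀ k : ℕ, 0 < Gamma (k + a + 1) := fun k =>
    Real.Gamma_pos_of_pos (by have : (0 : ℝ) ≤ k := by positivity
                              linarith)
  have key := hasSum_integral_of_summable_integral_norm (μ := volume.restrict (Ioi (0 : ℝ)))
    (F := fun (k : ℕ) u => (-(z / 2) ^ 2) ^ k / ((Nat.factorial k : ℝ) * Gamma (k + a + 1)) *
      (u ^ (2 * a + 1 + 2 * k) * f u)) (fun k => (hint k).const_mul _) ?h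
  · simp_rw [integral_const_mul] at key
    refine (congrArg (HasSum _) ?_).mpr key
    refine setIntegral_congr_fun measurableSet_Ioi fun u hu => ?_
    have hu : 0 < u := hu
    simp only [besselSeries]
    rw [← tsum_mul_left, ← tsum_mul_right]
    refine tsum_congr fun k => ?_
    rw [rpow_add hu (2 * a + 1) (2 * k), show (2 * (k : ℝ)) = ((2 * k : ℕ) : ℝ) by push_cast; ring, rpow_natCast,
      neg_pow ((z / 2) ^ 2), mul_div_assoc u, mul_pow, ← pow_mul]
    ring
  · convert hsum using 2 with k
    rw [← integral_const_mul]
    refine setIntegral_congr_fun measurableSet_Ioi fun u hu => ?_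
    have hu : 0 < u := hu
    have := hf u hu
    have := hG k
    simp only [norm_mul, norm_div, norm_pow, norm_neg, norm_eq_abs, Nat.abs_cast, abs_two]
    rw [abs_of_pos (hG k), abs_of_nonneg (hf u hu), abs_of_nonneg (rpow_nonneg hu.le _)]
    rw [div_pow |z|, sq_abs, ← div_pow]

/-! ### Beta and Gaussian moments, and the Hankel transforms they give. -/

theorem integrableOn_beta {s t : ℝ} (hs : 0 < s) (ht : 0 < t) :
    IntegrableOn (fun x : ℝ => x ^ (s - 1) * (1 - x) ^ (t - 1)) (Ioo 0 1) := by
  have h := (Complex.betaIntegral_convergent (u := s) (v := t) (by simpa) (by simpa))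
  rw [intervalIntegrable_iff_integrableOn_Ioo_of_le zero_le_one] at h
  refine h.re.congr ?_
  filter_upwards [ae_restrict_mem measurableSet_Ioo] with x hx
  have h1 : ((x : ℂ) ^ ((s : ℂ) - 1)) = ((x ^ (s - 1) : ℝ) : ℂ) := by
    rw [Complex.ofReal_cpow hx.1.le]; push_cast; rfl
  have h2 : ((1 - x : ℂ) ^ ((t : ℂ) - 1)) = (((1 - x) ^ (t - 1) : ℝ) : ℂ) := by
    rw [Complex.ofReal_cpow (by linarith [hx.2])]; push_cast; rfl
  rw [h1, h2, ← Complex.ofReal_mul]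
  simp

theorem integral_beta {s t : ℝ} (hs : 0 < s) (ht : 0 < t) :
    ∫ x in Ioo (0 : ℝ) 1, x ^ (s - 1) * (1 - x) ^ (t - 1) = Gamma s * Gamma t / Gamma (s + t) := by
  have h := ProbabilityTheory.beta_eq_betaIntegralReal s t hs ht
  rw [ProbabilityTheory.beta] at h
  rw [h, Complex.betaIntegral, intervalIntegral.integral_of_le zero_le_one,
    integral_Ioc_eq_integral_Ioo]
  have : ∫ x in Ioo (0 : ℝ) 1, (x : ℂ) ^ ((s : ℂ) - 1) * (1 - (x : ℂ)) ^ ((t : ℂ) - 1) =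
      ∫ x in Ioo (0 : ℝ) 1, ((x ^ (s - 1) * (1 - x) ^ (t - 1) : ℝ) : ℂ) := by
    refine setIntegral_congr_fun measurableSet_Ioo fun x hx => ?_
    have h1 : ((x : ℂ) ^ ((s : ℂ) - 1)) = ((x ^ (s - 1) : ℝ) : ℂ) := by
      rw [Complex.ofReal_cpow hx.1.le]; push_cast; rfl
    have h2 : ((1 - x : ℂ) ^ ((t : ℂ) - 1)) = (((1 - x) ^ (t - 1) : ℝ) : ℂ) := by
      rw [Complex.ofReal_cpow (by linarith [hx.2])]; push_cast; rfl
    rw [h1, h2, ← Complex.ofReal_mul]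
  rw [this, integral_complex_ofReal, Complex.ofReal_re]

/-- The substitution `x ↦ x ^ 2` turns this into a Beta integral; the indicator keeps the domain
`Ioi 0`, on which power substitutions act. -/
theorem integrableOn_and_integral_rpow_mul_one_sub_sq {s t : ℝ} (hs : 0 < s) (ht : 0 < t) :
    IntegrableOn (fun x : ℝ => x ^ (s - 1) * (Iio 1).indicator (fun x => (1 - x ^ 2) ^ (t - 1)) x)
      (Ioi 0) ∧
    ∫ x in Ioi (0 : ℝ), x ^ (s - 1) * (Iio 1).indicator (fun x => (1 - x ^ 2) ^ (t - 1)) x =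
      1 / 2 * (Gamma (s / 2) * Gamma t / Gamma (s / 2 + t)) := by
  set g : ℝ → ℝ := (Iio 1).indicator (fun x => x ^ (s / 2 - 1) * (1 - x) ^ (t - 1)) with hg
  have hgi : IntegrableOn g (Ioi 0) := by
    rw [hg, IntegrableOn, integrable_indicator_iff measurableSet_Iio, IntegrableOn,
      Measure.restrict_restrict measurableSet_Iio, inter_comm, Ioi_inter_Iio]
    exact integrableOn_beta (by positivity) ht
  have hgv : ∫ x in Ioi (0 : ℝ), g x = Gamma (s / 2) * Gamma t / Gamma (s / 2 + t) := by
    rw [hg, setIntegral_indicator measurableSet_Iio, Ioi_inter_Iio]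
    exact integral_beta (by positivity) ht
  have hcongr : ∀ x ∈ Ioi (0 : ℝ), (|2| * x ^ ((2 : ℝ) - 1)) • g (x ^ (2 : ℝ)) =
      2 * (x ^ (s - 1) * (Iio 1).indicator (fun x => (1 - x ^ 2) ^ (t - 1)) x) := by
    intro x hx
    have hx : 0 < x := hx
    rw [rpow_two, hg, abs_two, smul_eq_mul]
    by_cases h : x < 1
    · rw [indicator_of_mem (show x ^ 2 ∈ Iio 1 by simp only [mem_Iio]; nlinarith),
        indicator_of_mem (show x ∈ Iio 1 from h), ← rpow_two x, ← rpow_mul hx.le]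
      have : x ^ (s - 1) = x ^ ((2 : ℝ) - 1) * x ^ (2 * (s / 2 - 1)) := by
        rw [← rpow_add hx]; congr 1; ring
      rw [this]; ring
    · rw [indicator_of_notMem (show x ^ 2 ∉ Iio 1 by simp only [mem_Iio]; nlinarith),
        indicator_of_notMem (show x ∉ Iio 1 from h)]
      ring
  constructor
  · have h := (integrableOn_Ioi_comp_rpow_iff g (p := 2) (by norm_num)).mpr hgi
    rw [integrableOn_congr_fun hcongr measurableSet_Ioi] at h
    exact (integrable_const_mul_iff (isUnit_iff_ne_zero.mpr two_ne_zero) _).mp h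
  · have h := integral_comp_rpow_Ioi g (p := 2) (by norm_num)
    rw [hgv, setIntegral_congr_fun measurableSet_Ioi hcongr, integral_const_mul] at h
    linarith

theorem integrableOn_and_integral_rpow_mul_exp_neg_mul_sq {s p : ℝ} (hs : 0 < s) (hp : 0 < p) :
    IntegrableOn (fun x : ℝ => x ^ (s - 1) * exp (-p * x ^ 2)) (Ioi 0) ∧
    ∫ x in Ioi (0 : ℝ), x ^ (s - 1) * exp (-p * x ^ 2) = 1 / 2 * p ^ (-(s / 2)) * Gamma (s / 2) := by
  constructor
  · exact integrableOn_rpow_mul_exp_neg_mul_sq hp (by linarith)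
  · have h := integral_rpow_mul_exp_neg_mul_rpow (p := 2) (q := s - 1) (b := p) (by norm_num)
      (by linarith) hp
    simp only [rpow_two] at h
    rw [h]
    have : (s - 1 + 1) / 2 = s / 2 := by ring
    rw [neg_div, this]; ring

/-- The Hankel transform of a Gaussian. -/
theorem integral_rpow_mul_besselSeries_mul_exp_neg_mul_sq {a p : ℝ} (ha : -1 < a) (hp : 0 < p)
    (z : ℝ) :
    ∫ u in Ioi (0 : ℝ), u ^ (2 * a + 1) * besselSeries a (u * z) * exp (-p * u ^ 2) =
      1 / 2 * p ^ (-(a + 1)) * exp (-z ^ 2 / (4 * p)) := by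
  have hmom : ∀ k : ℕ, IntegrableOn (fun u : ℝ => u ^ (2 * a + 1 + 2 * k) * exp (-p * u ^ 2))
        (Ioi 0) ∧
      ∫ u in Ioi (0 : ℝ), u ^ (2 * a + 1 + 2 * k) * exp (-p * u ^ 2) =
        1 / 2 * p ^ (-(a + 1)) * (p⁻¹ ^ k * Gamma (k + a + 1)) := by
    intro k
    have hk : (0 : ℝ) ≤ k := by positivity
    have h := integrableOn_and_integral_rpow_mul_exp_neg_mul_sq
      (s := 2 * a + 2 + 2 * k) (by linarith) hp
    have e1 : 2 * a + 2 + 2 * (k : ℝ) - 1 = 2 * a + 1 + 2 * k := by ring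
    have e2 : (2 * a + 2 + 2 * (k : ℝ)) / 2 = k + a + 1 := by ring
    rw [e1, e2] at h
    refine ⟨h.1, h.2.trans ?_⟩
    rw [show -((k : ℝ) + a + 1) = -(a + 1) + -(k : ℝ) by ring, rpow_add hp, rpow_neg hp.le (k : ℝ),
      rpow_natCast, inv_pow]
    ring
  have hG : ∀ k : ℕ, Gamma (k + a + 1) ≠ 0 := fun k =>
    (Real.Gamma_pos_of_pos (by have : (0 : ℝ) ≤ k := by positivity
                               linarith)).ne'
  have hterm : ∀ (y : ℝ) (k : ℕ), y ^ k / ((Nat.factorial k : ℝ) * Gamma (k + a + 1)) *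
      (1 / 2 * p ^ (-(a + 1)) * (p⁻¹ ^ k * Gamma (k + a + 1))) =
      1 / 2 * p ^ (-(a + 1)) * ((y * p⁻¹) ^ k / (Nat.factorial k : ℝ)) := by
    intro y k
    have := hG k
    rw [mul_pow]
    field_simp
  have key := hasSum_integral_rpow_mul_besselSeries ha
    (f := fun u => exp (-p * u ^ 2)) (fun u _ => (exp_pos _).le) z (fun k => (hmom k).1) (by
      simp_rw [fun k => (hmom k).2, hterm]
      exact (Real.summable_pow_div_factorial _).mul_left _)
  simp_rw [fun k => (hmom k).2, hterm] at key
  refine key.unique ?_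
  have h := NormedSpace.expSeries_div_hasSum_exp (-(z / 2) ^ 2 * p⁻¹ : ℝ)
  rw [← Real.exp_eq_exp_ℝ] at h
  have e : -z ^ 2 / (4 * p) = -(z / 2) ^ 2 * p⁻¹ := by field_simp; norm_num
  rw [e]
  exact h.mul_left _

/-- Sonine's first integral. -/
theorem integral_rpow_mul_besselSeries_mul_one_sub_sq {a b : ℝ} (ha : -1 < a) (hb : 0 < b)
    (z : ℝ) :
    ∫ u in Ioi (0 : ℝ), u ^ (2 * a + 1) * besselSeries a (u * z) *
        (Iio 1).indicator (fun u => (1 - u ^ 2) ^ (b - 1)) u =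
      1 / 2 * Gamma b * besselSeries (a + b) z := by
  have hG : ∀ k : ℕ, 0 < Gamma (k + a + 1) := fun k =>
    Real.Gamma_pos_of_pos (by have : (0 : ℝ) ≤ k := by positivity
                              linarith)
  have hmom : ∀ k : ℕ, IntegrableOn (fun u : ℝ => u ^ (2 * a + 1 + 2 * k) *
        (Iio 1).indicator (fun u => (1 - u ^ 2) ^ (b - 1)) u) (Ioi 0) ∧
      ∫ u in Ioi (0 : ℝ), u ^ (2 * a + 1 + 2 * k) *
        (Iio 1).indicator (fun u => (1 - u ^ 2) ^ (b - 1)) u =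
        1 / 2 * (Gamma (k + a + 1) * Gamma b / Gamma (k + (a + b) + 1)) := by
    intro k
    have hk : (0 : ℝ) ≤ k := by positivity
    have h := integrableOn_and_integral_rpow_mul_one_sub_sq
      (s := 2 * a + 2 + 2 * k) (by linarith) hb
    have e1 : 2 * a + 2 + 2 * (k : ℝ) - 1 = 2 * a + 1 + 2 * k := by ring
    have e2 : (2 * a + 2 + 2 * (k : ℝ)) / 2 = k + a + 1 := by ring
    have e3 : (k : ℝ) + a + 1 + b = k + (a + b) + 1 := by ring
    rwa [e1, e2, e3] at h
  have hterm : ∀ (y : ℝ) (k : ℕ), y ^ k / ((Nat.factorial k : ℝ) * Gamma (k + a + 1)) *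
      (1 / 2 * (Gamma (k + a + 1) * Gamma b / Gamma (k + (a + b) + 1))) =
      1 / 2 * Gamma b * (y ^ k / ((Nat.factorial k : ℝ) * Gamma (k + (a + b) + 1))) := by
    intro y k
    have := (hG k).ne'
    field_simp
  have hab : -1 < a + b := by linarith
  have key := hasSum_integral_rpow_mul_besselSeries ha
    (f := (Iio 1).indicator (fun u => (1 - u ^ 2) ^ (b - 1))) (fun u hu => by
      refine indicator_apply_nonneg fun hu1 => ?_
      exact rpow_nonneg (by have : u < 1 := hu1
                            nlinarith) _) z (fun k => (hmom k).1) (by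
      simp_rw [fun k => (hmom k).2, hterm]
      exact (summable_pow_div_factorial_mul_Gamma hab _).mul_left _)
  simp_rw [fun k => (hmom k).2, hterm] at key
  refine key.unique ?_
  have h := (summable_besselSeries hab z).hasSum.mul_left (1 / 2 * Gamma b)
  rw [besselSeries]
  refine (congrArg (fun F => HasSum F _) (funext fun k => ?_)).mpr h
  rw [neg_pow ((z / 2) ^ 2), pow_mul, mul_div_right_comm]

/-! ### Bounds and decay for the Bessel kernel. -/

theorem integrableOn_one_sub_sq_rpow {c : ℝ} (hc : -1 < c) :
    IntegrableOn (fun u : ℝ => (1 - u ^ 2) ^ c) (Ioo 0 1) := by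
  have h := (integrableOn_and_integral_rpow_mul_one_sub_sq (s := 1) (t := c + 1) one_pos
    (by linarith)).1
  simp only [sub_self, rpow_zero, one_mul, add_sub_cancel_right] at h
  rw [IntegrableOn, integrable_indicator_iff measurableSet_Iio, IntegrableOn,
    Measure.restrict_restrict measurableSet_Iio, inter_comm, Ioi_inter_Iio] at h
  exact h

/-- Poisson's integral representation. -/
theorem besselSeries_eq_integral_cos {a : ℝ} (ha : -1 / 2 < a) (x : ℝ) :
    besselSeries a x = 2 / (√π * Gamma (a + 1 / 2)) *
      ∫ u in Ioo (0 : ℝ) 1, (1 - u ^ 2) ^ (a - 1 / 2) * cos (x * u) := by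
  have h := integral_rpow_mul_besselSeries_mul_one_sub_sq (a := -1 / 2) (b := a + 1 / 2)
    (by norm_num) (by linarith) x
  have e : -1 / 2 + (a + 1 / 2) = a := by ring
  have hG : 0 < Gamma (a + 1 / 2) := Real.Gamma_pos_of_pos (by linarith)
  have hpi : 0 < √π := by positivity
  have h2 : ∫ u in Ioi (0 : ℝ), u ^ (2 * (-1 / 2 : ℝ) + 1) * besselSeries (-1 / 2) (u * x) *
        (Iio 1).indicator (fun u => (1 - u ^ 2) ^ (a + 1 / 2 - 1)) u =
      1 / √π * ∫ u in Ioo (0 : ℝ) 1, (1 - u ^ 2) ^ (a - 1 / 2) * cos (x * u) := by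
    rw [← Ioi_inter_Iio, ← setIntegral_indicator measurableSet_Iio, ← integral_const_mul]
    congr 1
    funext u
    rw [besselSeries_neg_half, show 2 * (-1 / 2 : ℝ) + 1 = 0 by norm_num, rpow_zero]
    by_cases hu : u ∈ Iio (1 : ℝ)
    · rw [indicator_of_mem hu, indicator_of_mem hu, mul_comm x u,
        show a + 1 / 2 - 1 = a - 1 / 2 by ring]
      ring
    · simp [indicator_of_notMem hu]
  rw [h2, e] at h
  generalize (∫ u in Ioo (0 : ℝ) 1, (1 - u ^ 2) ^ (a - 1 / 2) * cos (x * u)) = I at h ⊢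
  generalize Gamma (a + 1 / 2) = G at h hG ⊢
  rw [eq_comm, div_mul_eq_mul_div, div_eq_iff (by positivity)]
  field_simp at h
  linarith

theorem abs_integral_one_sub_sq_rpow_mul_cos_le {c : ℝ} (hc : -1 < c) (x : ℝ) :
    |∫ u in Ioo (0 : ℝ) 1, (1 - u ^ 2) ^ c * cos (x * u)| ≤
      ∫ u in Ioo (0 : ℝ) 1, (1 - u ^ 2) ^ c := by
  rw [← norm_eq_abs]
  refine norm_integral_le_of_norm_le (integrableOn_one_sub_sq_rpow hc) ?_
  filter_upwards [ae_restrict_mem measurableSet_Ioo] with u hu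
  have h : 0 ≤ (1 - u ^ 2) ^ c := rpow_nonneg (by nlinarith [hu.1, hu.2]) _
  rw [norm_mul, norm_eq_abs, norm_eq_abs, abs_of_nonneg h]
  exact mul_le_of_le_one_right h (abs_cos_le_one _)

/-- The range `a ≥ -1/2` corresponds to `d ≥ 1`. This bound justifies the later uses of Fubini
against the Bessel kernel. -/
theorem exists_abs_besselSeries_le {a : ℝ} (ha : -1 / 2 ≤ a) :
    ∃ C, 0 ≤ C ∧ ∀ x, |besselSeries a x| ≤ C := by
  rcases ha.eq_or_lt with rfl | ha
  · refine ⟨1 / √π, by positivity, fun x => ?_⟩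
    rw [besselSeries_neg_half, abs_div, abs_of_pos (show 0 < √π by positivity)]
    gcongr
    exact abs_cos_le_one x
  · have hb := abs_integral_one_sub_sq_rpow_mul_cos_le (c := a - 1 / 2) (by linarith)
    refine ⟨|2 / (√π * Gamma (a + 1 / 2))| * ∫ u in Ioo (0 : ℝ) 1, (1 - u ^ 2) ^ (a - 1 / 2),
      mul_nonneg (abs_nonneg _) ((abs_nonneg _).trans (hb 0)), fun x => ?_⟩
    rw [besselSeries_eq_integral_cos ha, abs_mul]
    gcongr
    exact hb x

/-- Integration by parts against `sin (x * u) / x`. Since `c < 0` the weight is increasing, so its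
total variation is at most its value at `b`; the boundary term and the remaining integral each
contribute one copy of `(1 - b) ^ c / x`. -/
theorem abs_integral_one_sub_sq_rpow_mul_cos_head_le {b c x : ℝ} (hb0 : 0 ≤ b) (hb1 : b < 1)
    (hc : c < 0) (hx : 0 < x) :
    |∫ u in (0 : ℝ)..b, (1 - u ^ 2) ^ c * cos (x * u)| ≤ 2 * (1 - b) ^ c / x := by
  have hpos : ∀ u ∈ uIcc 0 b, 0 < 1 - u ^ 2 := by
    intro u hu
    rw [uIcc_of_le hb0] at hu
    nlinarith [hu.1, hu.2]
  have hf : ∀ u ∈ uIcc 0 b, HasDerivAt (fun u : ℝ => (1 - u ^ 2) ^ c)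
      (-(2 * u) * c * (1 - u ^ 2) ^ (c - 1)) u := by
    intro u hu
    have h1 : HasDerivAt (fun u : ℝ => 1 - u ^ 2) (-(2 * u)) u := by
      simpa using (hasDerivAt_pow 2 u).const_sub 1
    exact h1.rpow_const (Or.inl (hpos u hu).ne')
  have hg : ∀ u ∈ uIcc 0 b, HasDerivAt (fun u : ℝ => sin (x * u) / x) (cos (x * u)) u := by
    intro u _
    have h1 : HasDerivAt (fun u : ℝ => x * u) x u := by simpa using (hasDerivAt_id u).const_mul x
    have h2 := (h1.sin).div_const x
    rwa [mul_div_cancel_right₀ _ hx.ne'] at h2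
  have hf' : ContinuousOn (fun u : ℝ => -(2 * u) * c * (1 - u ^ 2) ^ (c - 1)) (uIcc 0 b) :=
    ContinuousOn.mul (by fun_prop)
      (ContinuousOn.rpow_const (by fun_prop) fun u hu => Or.inl (hpos u hu).ne')
  have hf'i := hf'.intervalIntegrable (μ := volume)
  rw [intervalIntegral.integral_mul_deriv_eq_deriv_mul hf hg hf'i
    (by apply Continuous.intervalIntegrable; fun_prop)]
  have hF := intervalIntegral.integral_eq_sub_of_hasDerivAt hf hf'i
  have hfb : (1 - b ^ 2) ^ c ≤ (1 - b) ^ c :=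
    rpow_le_rpow_of_nonpos (by linarith) (by nlinarith) hc.le
  have hfb0 : 0 ≤ (1 - b ^ 2) ^ c := rpow_nonneg (by nlinarith) _
  have h1 : |(1 - b ^ 2) ^ c * (sin (x * b) / x)| ≤ (1 - b ^ 2) ^ c / x := by
    rw [abs_mul, abs_of_nonneg hfb0, abs_div, abs_of_pos hx, ← mul_div_assoc]
    gcongr
    exact mul_le_of_le_one_right hfb0 (abs_sin_le_one _)
  have h2 : |∫ u in (0 : ℝ)..b, -(2 * u) * c * (1 - u ^ 2) ^ (c - 1) * (sin (x * u) / x)| ≤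
      (1 - b ^ 2) ^ c / x := by
    rw [← norm_eq_abs]
    refine (intervalIntegral.norm_integral_le_of_norm_le hb0
      (g := fun u => -(2 * u) * c * (1 - u ^ 2) ^ (c - 1) / x) ?_ (hf'i.div_const x)).trans ?_
    · refine ae_of_all _ fun u hu => ?_
      have hu' : u ∈ uIcc 0 b := by rw [uIcc_of_le hb0]; exact ⟨hu.1.le, hu.2⟩
      have h3 : 0 ≤ -(2 * u) * c * (1 - u ^ 2) ^ (c - 1) :=
        mul_nonneg (by nlinarith [hu.1]) (rpow_nonneg (hpos u hu').le _)
      rw [norm_mul, norm_eq_abs, norm_eq_abs, abs_of_nonneg h3, abs_div, abs_of_pos hx,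
        ← mul_div_assoc]
      exact div_le_div_of_nonneg_right (mul_le_of_le_one_right h3 (abs_sin_le_one _)) hx.le
    · rw [intervalIntegral.integral_div, hF]
      gcongr
      simp
  simp only [mul_zero, sin_zero, zero_div, sub_zero]
  refine (abs_sub _ _).trans ((add_le_add h1 h2).trans ?_)
  rw [← add_div]
  gcongr
  linarith

/-- The decay `J_a(x) = O(x ^ (-1/2))` for orders where the Poisson weight is singular at 1.
Oscillation controls the integral away from 1, smallness of the interval controls it near 1. -/
theorem exists_abs_besselSeries_le_rpow {a : ℝ} (ha : -1 / 2 < a) (ha' : a < 1 / 2) :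
    ∃ C, 0 ≤ C ∧ ∀ x, 0 < x → |besselSeries a x| ≤ C * x ^ (-(a + 1 / 2)) := by
  set c := a - 1 / 2 with hc
  have hc1 : -1 < c := by linarith
  have hc0 : c < 0 := by linarith
  set M := ∫ u in Ioo (0 : ℝ) 1, (1 - u ^ 2) ^ c with hM
  have hM0 : 0 ≤ M := (abs_nonneg _).trans (abs_integral_one_sub_sq_rpow_mul_cos_le hc1 0)
  have hc2 : 0 < c + 1 := by linarith
  suffices h : ∀ x, 0 < x → |∫ u in Ioo (0 : ℝ) 1, (1 - u ^ 2) ^ c * cos (x * u)| ≤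
      (M + (2 + 1 / (c + 1))) * x ^ (-(c + 1)) by
    refine ⟨|2 / (√π * Gamma (a + 1 / 2))| * (M + (2 + 1 / (c + 1))), by positivity, fun x hx => ?_⟩
    rw [besselSeries_eq_integral_cos ha, abs_mul, mul_assoc,
      show a + 1 / 2 = c + 1 by rw [hc]; ring]
    gcongr
    exact h x hx
  intro x hx
  rcases le_or_gt x 1 with hx1 | hx1
  · have h1 : 1 ≤ x ^ (-(c + 1)) := one_le_rpow_of_pos_of_le_one_of_nonpos hx hx1 (by linarith)
    calc _ ≤ M := abs_integral_one_sub_sq_rpow_mul_cos_le hc1 x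
      _ ≤ M + (2 + 1 / (c + 1)) := by
        have : 0 ≤ 2 + 1 / (c + 1) := by positivity
        linarith
      _ ≤ _ := le_mul_of_one_le_right (by positivity) h1
  -- Cutting at distance `1 / x` from the singularity balances the two parts: both become multiples
  -- of `x ^ (-(c + 1))`.
  · set b := 1 - 1 / x with hb
    have hb1 : b < 1 := by rw [hb]; linarith [one_div_pos.mpr hx]
    have hb0 : 0 ≤ b := by
      rw [hb, sub_nonneg, div_le_one hx]; exact hx1.le
    have hint : IntegrableOn (fun u : ℝ => (1 - u ^ 2) ^ c * cos (x * u)) (Ioo 0 1) := by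
      refine (integrableOn_one_sub_sq_rpow hc1).mul_of_top_left ?_
      exact memLp_top_of_bound (by fun_prop) 1 (ae_of_all _ fun u => abs_cos_le_one _)
    have hII : IntervalIntegrable (fun u : ℝ => (1 - u ^ 2) ^ c * cos (x * u)) volume 0 1 := by
      rwa [intervalIntegrable_iff_integrableOn_Ioo_of_le zero_le_one]
    have hbmem : b ∈ uIcc (0 : ℝ) 1 := by rw [uIcc_of_le zero_le_one]; exact ⟨hb0, hb1.le⟩
    have hxc : (1 - b) ^ (c + 1) = x ^ (-(c + 1)) := by
      rw [hb, sub_sub_cancel, one_div, inv_rpow hx.le, rpow_neg hx.le]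
    have htail : |∫ u in b..1, (1 - u ^ 2) ^ c * cos (x * u)| ≤ x ^ (-(c + 1)) / (c + 1) := by
      have hi : IntervalIntegrable (fun u : ℝ => (1 - u) ^ c) volume b 1 := by
        have h := (intervalIntegral.intervalIntegrable_rpow' (a := 1 - b) (b := 0) hc1).comp_sub_left 1
        simpa using h
      have hval : ∫ u in b..1, (1 - u) ^ c = x ^ (-(c + 1)) / (c + 1) := by
        rw [intervalIntegral.integral_comp_sub_left (fun u => u ^ c) 1, sub_self,
          integral_rpow (Or.inl hc1), zero_rpow hc2.ne', hxc, sub_zero]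
      rw [← norm_eq_abs, ← hval]
      refine intervalIntegral.norm_integral_le_of_norm_le hb1.le ?_ hi
      -- The endpoint is discarded because comparing negative powers needs a positive base `1 - u`.
      have : ∀ᵐ u : ℝ, u ≠ 1 := by simp [ae_iff]
      filter_upwards [this] with u hu1 hu
      have hu1 : u < 1 := lt_of_le_of_ne hu.2 hu1
      have hu0 : 0 ≤ u := hb0.trans hu.1.le
      have h0 : 0 ≤ (1 - u ^ 2) ^ c := rpow_nonneg (by nlinarith) _
      rw [norm_mul, norm_eq_abs, norm_eq_abs, abs_of_nonneg h0]
      refine (mul_le_of_le_one_right h0 (abs_cos_le_one _)).trans ?_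
      exact rpow_le_rpow_of_nonpos (by linarith) (by nlinarith) hc0.le
    have hhead := abs_integral_one_sub_sq_rpow_mul_cos_head_le hb0 hb1 hc0 hx
    have e : 2 * (1 - b) ^ c / x = 2 * x ^ (-(c + 1)) := by
      rw [← hxc, rpow_add_one (by linarith), hb]
      field_simp
      ring
    rw [e] at hhead
    rw [← integral_Ioc_eq_integral_Ioo, ← intervalIntegral.integral_of_le zero_le_one,
      ← intervalIntegral.integral_add_adjacent_intervals (b := b)
        (hII.mono_set (uIcc_subset_uIcc left_mem_uIcc hbmem))
        (hII.mono_set (uIcc_subset_uIcc hbmem right_mem_uIcc))]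
    refine (abs_add_le _ _).trans ((add_le_add hhead htail).trans ?_)
    have : 0 ≤ M * x ^ (-(c + 1)) := by positivity
    have e2 : x ^ (-(c + 1)) / (c + 1) = 1 / (c + 1) * x ^ (-(c + 1)) := by ring
    rw [e2]
    linarith

/-! ### Spectral densities and Fourier inversion at the origin. -/

theorem spectralDensity_congr (d : ℕ) {φ ψ : ℝ → ℝ} (h : ∀ u, 0 < u → φ u = ψ u) :
    spectralDensity d φ = spectralDensity d ψ := by
  funext z
  rw [spectralDensity, spectralDensity]
  congr 1
  refine setIntegral_congr_fun measurableSet_Ioi fun u hu => ?_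
  simp only [h u hu]

/-- Once `(u * z / 2) ^ (d / 2 - 1)` is taken out of the Bessel function, all powers of `z` cancel
and the weight becomes `u ^ (d - 1)`, written with the exponent `2 * a + 1` of the Hankel lemmas. -/
theorem spectralDensity_eq_integral_besselSeries (d : ℕ) (φ : ℝ → ℝ) {z : ℝ} (hz : 0 < z) :
    spectralDensity d φ z = 2 ^ (1 - (d : ℝ)) * π ^ (-(d : ℝ) / 2) *
      ∫ u in Ioi (0 : ℝ), u ^ (2 * ((d : ℝ) / 2 - 1) + 1) * besselSeries ((d : ℝ) / 2 - 1) (u * z) *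
        φ u := by
  have hI : ∫ u in Ioi (0 : ℝ), u ^ ((d : ℝ) / 2) * besselJ ((d : ℝ) / 2 - 1) (u * z) * φ u =
      (z / 2) ^ ((d : ℝ) / 2 - 1) * ∫ u in Ioi (0 : ℝ), u ^ (2 * ((d : ℝ) / 2 - 1) + 1) *
        besselSeries ((d : ℝ) / 2 - 1) (u * z) * φ u := by
    rw [← integral_const_mul]
    refine setIntegral_congr_fun measurableSet_Ioi fun u hu => ?_
    have hu : 0 < u := hu
    rw [besselJ_eq_rpow_mul_besselSeries _ (by positivity), mul_div_assoc,
      mul_rpow hu.le (by positivity),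
      show 2 * ((d : ℝ) / 2 - 1) + 1 = (d : ℝ) / 2 + ((d : ℝ) / 2 - 1) by ring, rpow_add hu]
    ring
  rw [spectralDensity, hI, ← mul_assoc]
  congr 1
  rw [div_rpow hz.le zero_le_two, mul_rpow zero_le_two pi_pos.le, div_mul_div_comm,
    ← rpow_add hz, show 1 - (d : ℝ) / 2 + ((d : ℝ) / 2 - 1) = 0 by ring, rpow_zero,
    mul_right_comm, ← rpow_add two_pos, neg_div, rpow_neg pi_pos.le,
    show (d : ℝ) / 2 + ((d : ℝ) / 2 - 1) = -(1 - (d : ℝ)) by ring, rpow_neg zero_le_two]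
  have h1 : (0 : ℝ) < 2 ^ (1 - (d : ℝ)) := by positivity
  field_simp

theorem pow_sub_one_eq_rpow {d : ℕ} (hd : 1 ≤ d) (z : ℝ) :
    z ^ (d - 1) = z ^ (2 * ((d : ℝ) / 2 - 1) + 1) := by
  rw [← rpow_natCast, Nat.cast_sub hd]
  congr 1
  push_cast
  ring

/-- Exchanging the order of integration in the Gaussian regularization of a Hankel transform. -/
theorem integral_hankel_mul_exp_neg_mul_sq {a p : ℝ} (ha : -1 / 2 ≤ a) (hp : 0 < p) {φ : ℝ → ℝ}
    (hφi : IntegrableOn (fun u => u ^ (2 * a + 1) * φ u) (Ioi 0)) :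
    ∫ z in Ioi (0 : ℝ), z ^ (2 * a + 1) * exp (-p * z ^ 2) *
        ∫ u in Ioi (0 : ℝ), u ^ (2 * a + 1) * besselSeries a (u * z) * φ u =
      ∫ u in Ioi (0 : ℝ), u ^ (2 * a + 1) * φ u *
        (1 / 2 * p ^ (-(a + 1)) * exp (-u ^ 2 / (4 * p))) := by
  obtain ⟨C, -, hC⟩ := exists_abs_besselSeries_le ha
  have hg : IntegrableOn (fun z : ℝ => z ^ (2 * a + 1) * exp (-p * z ^ 2)) (Ioi 0) := by
    have h := (integrableOn_and_integral_rpow_mul_exp_neg_mul_sq (s := 2 * a + 2) (by linarith) hp).1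
    rwa [show 2 * a + 2 - 1 = 2 * a + 1 by ring] at h
  have hprod : Integrable (Function.uncurry fun z u : ℝ => besselSeries a (u * z) *
      ((z ^ (2 * a + 1) * exp (-p * z ^ 2)) * (u ^ (2 * a + 1) * φ u)))
      ((volume.restrict (Ioi 0)).prod (volume.restrict (Ioi 0))) := by
    -- A bounded kernel times a product of two integrable functions of one variable.
    refine (Integrable.mul_prod hg hφi).bdd_mul (f := fun x : ℝ × ℝ => besselSeries a (x.2 * x.1))
      (c := C) ?_ (ae_of_all _ fun x => hC _)
    exact ((measurable_besselSeries (by linarith)).comp (by fun_prop)).aestronglyMeasurable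
  have hswap := integral_integral_swap hprod
  calc _ = ∫ z in Ioi (0 : ℝ), ∫ u in Ioi (0 : ℝ), besselSeries a (u * z) *
      ((z ^ (2 * a + 1) * exp (-p * z ^ 2)) * (u ^ (2 * a + 1) * φ u)) := by
        congr 1; funext z
        rw [← integral_const_mul]
        congr 1; funext u; ring
    _ = _ := hswap
    _ = _ := by
        congr 1; funext u
        rw [← integral_rpow_mul_besselSeries_mul_exp_neg_mul_sq (by linarith) hp,
          ← integral_const_mul]
        congr 1; funext z
        rw [mul_comm z u]; ring

/-- Fourier inversion at the origin for a radial function with integrable spectral density. -/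
theorem integral_pow_mul_spectralDensity {d : ℕ} (hd : 1 ≤ d) {φ : ℝ → ℝ} (hφm : Measurable φ)
    (hφb : ∀ u, 0 < u → |φ u| ≤ 1) (hφ0 : Filter.Tendsto φ (nhdsWithin 0 (Ioi 0)) (nhds 1))
    (hφi : IntegrableOn (fun u => u ^ (2 * ((d : ℝ) / 2 - 1) + 1) * φ u) (Ioi 0))
    (hφs : IntegrableOn (fun z => z ^ (d - 1) * spectralDensity d φ z) (Ioi 0)) :
    ∫ z in Ioi (0 : ℝ), z ^ (d - 1) * spectralDensity d φ z =
      Gamma ((d : ℝ) / 2) / (2 * π ^ ((d : ℝ) / 2)) := by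
  have hd' : (1 : ℝ) ≤ d := by exact_mod_cast hd
  set a : ℝ := (d : ℝ) / 2 - 1 with ha_def
  have ha : -1 / 2 ≤ a := by linarith
  set K : ℝ := 2 ^ (1 - (d : ℝ)) * π ^ (-(d : ℝ) / 2) with hK
  have hreg : ∀ t : ℝ, 0 < t →
      ∫ z in Ioi (0 : ℝ), exp (-(t ^ 2 / 4) * z ^ 2) * (z ^ (d - 1) * spectralDensity d φ z) =
        K * (1 / 2 * 4 ^ (a + 1)) *
          ∫ v in Ioi (0 : ℝ), φ (t * v) * (v ^ (2 * a + 1) * exp (-1 * v ^ 2)) := by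
    intro t ht
    have h1 := integral_hankel_mul_exp_neg_mul_sq ha (p := t ^ 2 / 4) (by positivity) hφi
    -- The substitution `u = t * v` moves the regularization parameter into the argument of `φ`,
    -- leaving a fixed Gaussian weight.
    have h2 := integral_comp_mul_left_Ioi (fun u => u ^ (2 * a + 1) * φ u *
        (1 / 2 * (t ^ 2 / 4) ^ (-(a + 1)) * exp (-u ^ 2 / (4 * (t ^ 2 / 4))))) 0 ht
    rw [mul_zero, ← h1, smul_eq_mul, eq_inv_mul_iff_mul_eq₀ ht.ne'] at h2
    calc _ = K * ∫ z in Ioi (0 : ℝ), z ^ (2 * a + 1) * exp (-(t ^ 2 / 4) * z ^ 2) *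
        ∫ u in Ioi (0 : ℝ), u ^ (2 * a + 1) * besselSeries a (u * z) * φ u := by
          rw [← integral_const_mul]
          refine setIntegral_congr_fun measurableSet_Ioi fun z hz => ?_
          rw [spectralDensity_eq_integral_besselSeries d φ hz, pow_sub_one_eq_rpow hd]
          ring
      _ = _ := by
          rw [← h2, mul_assoc K]
          congr 1
          rw [← integral_const_mul, ← integral_const_mul]
          refine setIntegral_congr_fun measurableSet_Ioi fun v hv => ?_
          have hv : 0 < v := hv
          have e1 : -(t * v) ^ 2 / (4 * (t ^ 2 / 4)) = -1 * v ^ 2 := by field_simp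
          have e2 : t * (t ^ (2 * a + 1) * (t ^ 2 / 4) ^ (-(a + 1))) = 4 ^ (a + 1) := by
            rw [div_rpow (by positivity) (by norm_num), ← rpow_natCast t 2, ← rpow_mul ht.le,
              rpow_neg (by norm_num : (0 : ℝ) ≤ 4), div_inv_eq_mul, ← mul_assoc, ← mul_assoc,
              ← rpow_one_add' ht.le (by linarith), ← rpow_add ht]
            have : 1 + (2 * a + 1) + ((2 : ℕ) : ℝ) * -(a + 1) = 0 := by push_cast; ring
            rw [this, rpow_zero, one_mul]
          rw [e1, mul_rpow ht.le hv.le, ← e2]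
          ring
  have hG := (integrableOn_and_integral_rpow_mul_exp_neg_mul_sq (s := 2 * a + 2) (p := 1)
    (by linarith) one_pos)
  rw [show 2 * a + 2 - 1 = 2 * a + 1 by ring, show (2 * a + 2) / 2 = (d : ℝ) / 2 by linarith,
    one_rpow, mul_one] at hG
  have hl : Filter.Tendsto (fun t : ℝ => ∫ z in Ioi (0 : ℝ), exp (-(t ^ 2 / 4) * z ^ 2) *
      (z ^ (d - 1) * spectralDensity d φ z)) (nhdsWithin 0 (Ioi 0))
      (nhds (∫ z in Ioi (0 : ℝ), z ^ (d - 1) * spectralDensity d φ z)) := by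
    -- The regularizing factor lies in `(0, 1]`, so the integrable density itself dominates as `t`
    -- tends to 0.
    refine tendsto_integral_filter_of_dominated_convergence _ (.of_forall fun t => ?_)
      (.of_forall fun t => ae_of_all _ fun z => ?_) hφs.norm (ae_of_all _ fun z => ?_)
    · exact AEStronglyMeasurable.mul (by fun_prop) hφs.aestronglyMeasurable
    · rw [norm_mul]
      refine mul_le_of_le_one_left (norm_nonneg _) ?_
      rw [norm_eq_abs, abs_exp, exp_le_one_iff]
      have : 0 ≤ t ^ 2 / 4 * z ^ 2 := by positivity
      linarith
    · have : Continuous fun t : ℝ => exp (-(t ^ 2 / 4) * z ^ 2) *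
        (z ^ (d - 1) * spectralDensity d φ z) := by fun_prop
      have h := (this.tendsto 0).mono_left (nhdsWithin_le_nhds (s := Ioi 0))
      simpa using h
  have hr : Filter.Tendsto (fun t : ℝ => K * (1 / 2 * 4 ^ (a + 1)) *
      ∫ v in Ioi (0 : ℝ), φ (t * v) * (v ^ (2 * a + 1) * exp (-1 * v ^ 2))) (nhdsWithin 0 (Ioi 0))
      (nhds (K * (1 / 2 * 4 ^ (a + 1)) *
        ∫ v in Ioi (0 : ℝ), 1 * (v ^ (2 * a + 1) * exp (-1 * v ^ 2)))) := by
    -- On the other side `|φ| ≤ 1` makes the Gaussian weight the majorant, and `φ (t * v)` tends to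
    -- 1 for each `v > 0`.
    refine Filter.Tendsto.const_mul _ ?_
    refine tendsto_integral_filter_of_dominated_convergence _ (.of_forall fun t => ?_)
      ?_ hG.1.norm ?_
    · exact (hφm.comp (measurable_const_mul t)).aestronglyMeasurable.mul hG.1.aestronglyMeasurable
    · filter_upwards [self_mem_nhdsWithin] with t ht
      filter_upwards [ae_restrict_mem measurableSet_Ioi] with v hv
      rw [norm_mul]
      exact mul_le_of_le_one_left (norm_nonneg _) (hφb _ (mul_pos ht hv))
    · filter_upwards [ae_restrict_mem measurableSet_Ioi] with v hv
      refine Filter.Tendsto.mul_const _ (hφ0.comp ?_)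
      refine tendsto_nhdsWithin_iff.mpr ⟨?_, ?_⟩
      · have h : Filter.Tendsto (fun t : ℝ => t * v) (nhds 0) (nhds (0 * v)) :=
          (continuous_id.mul continuous_const).tendsto 0
        rw [zero_mul] at h
        exact h.mono_left nhdsWithin_le_nhds
      · filter_upwards [self_mem_nhdsWithin] with t ht
        exact mul_pos (mem_Ioi.mp ht) (mem_Ioi.mp hv)
  have heq := tendsto_nhds_unique (hl.congr' (by
    filter_upwards [self_mem_nhdsWithin] with t ht using hreg t ht)) hr
  rw [heq]
  simp_rw [one_mul]
  rw [hG.2, hK, show a + 1 = (d : ℝ) / 2 by linarith, neg_div, rpow_neg pi_pos.le,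
    rpow_sub two_pos, rpow_one, show (4 : ℝ) = 2 ^ (2 : ℝ) by norm_num, ← rpow_mul zero_le_two,
    show 2 * ((d : ℝ) / 2) = d by ring]
  have h1 : (0 : ℝ) < 2 ^ (d : ℝ) := by positivity
  have h2 : (0 : ℝ) < π ^ ((d : ℝ) / 2) := by positivity
  field_simp

/-! ### The Matérn function and its spectral density. -/

theorem integrableOn_rpow_mul_exp_neg_mul_exp_neg_div {κ : ℝ} (hκ : 0 < κ) {y : ℝ} (hy : 0 ≤ y) :
    IntegrableOn (fun w : ℝ => w ^ (κ - 1) * exp (-w) * exp (-(y / w))) (Ioi 0) := by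
  have h := Real.GammaIntegral_convergent hκ
  refine (h.congr_fun (g := fun w => w ^ (κ - 1) * exp (-w)) (fun w _ => mul_comm _ _)
    measurableSet_Ioi).mul_bdd (c := 1) (by fun_prop) ?_
  filter_upwards [ae_restrict_mem measurableSet_Ioi] with w hw
  rw [norm_eq_abs, abs_exp, exp_le_one_iff, neg_nonpos]
  exact div_nonneg hy (mem_Ioi.mp hw).le

/-- `besselK` as a Laplace-type integral. -/
theorem besselK_eq_integral {κ x : ℝ} (hκ : 0 < κ) (hx : 0 < x) :
    besselK κ x = 1 / 2 * (x / 2) ^ (-κ) *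
      ∫ w in Ioi (0 : ℝ), w ^ (κ - 1) * exp (-w) * exp (-(x ^ 2 / 4 / w)) := by
  set g : ℝ → ℝ := fun w => w ^ (κ - 1) * exp (-w) * exp (-(x ^ 2 / 4 / w)) with hg
  set h : ℝ → ℝ := fun t => exp (-x * cosh t) * exp (κ * t) with hh
  -- The substitution `w = (x / 2) * exp t` turns `w + x ^ 2 / (4 * w)` into `x * cosh t`.
  have himg : (fun t => x / 2 * exp t) '' univ = Ioi 0 := by
    ext w
    simp only [image_univ, mem_range, mem_Ioi]
    constructor
    · rintro ⟨t, rfl⟩; positivity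
    · intro hw
      refine ⟨log (w / (x / 2)), ?_⟩
      rw [exp_log (by positivity)]
      field_simp
  have hderiv : ∀ t ∈ (univ : Set ℝ),
      HasDerivWithinAt (fun t => x / 2 * exp t) (x / 2 * exp t) univ t :=
    fun t _ => ((hasDerivAt_exp t).const_mul _).hasDerivWithinAt
  have hinj : InjOn (fun t => x / 2 * exp t) univ := by
    intro s _ t _ hst
    exact exp_injective (mul_left_cancel₀ (by positivity) hst)
  have hcongr : ∀ t, |x / 2 * exp t| • g (x / 2 * exp t) = (x / 2) ^ κ * h t := by
    intro t
    have e1 : x ^ 2 / 4 / (x / 2 * exp t) = x / 2 * exp (-t) := by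
      rw [exp_neg]; field_simp; norm_num
    have e2 : -x * cosh t = -(x / 2 * exp t) + -(x / 2 * exp (-t)) := by
      rw [cosh_eq]; ring
    have e3 : (x / 2 * exp t) ^ (κ - 1) = (x / 2) ^ κ * exp (κ * t) / (x / 2 * exp t) := by
      rw [rpow_sub_one (by positivity), mul_rpow (by positivity) (exp_pos t).le, ← exp_mul,
        mul_comm t κ]
    rw [abs_of_pos (by positivity), smul_eq_mul, hg, hh]
    simp only
    rw [e1, e2, e3, exp_add]
    field_simp
  have hgi : IntegrableOn g (Ioi 0) :=
    integrableOn_rpow_mul_exp_neg_mul_exp_neg_div hκ (by positivity)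
  have hhi : Integrable h := by
    rw [← himg, integrableOn_image_iff_integrableOn_abs_deriv_smul MeasurableSet.univ hderiv hinj,
      integrableOn_univ] at hgi
    simp_rw [hcongr] at hgi
    exact (integrable_const_mul_iff (isUnit_iff_ne_zero.mpr (by positivity)) _).mp hgi
  have hval : ∫ w in Ioi (0 : ℝ), g w = (x / 2) ^ κ * ∫ t, h t := by
    rw [← himg, integral_image_eq_integral_abs_deriv_smul MeasurableSet.univ hderiv hinj,
      setIntegral_univ, ← integral_const_mul]
    simp_rw [hcongr]
  have hneg : IntegrableOn (fun t => h (-t)) (Ioi 0) := hhi.comp_neg.integrableOn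
  -- Folding the line at the origin pairs `exp (κ * t)` with `exp (-κ * t)`, which gives `2 * cosh
  -- (κ * t)`.
  have hsplit : ∫ t, h t = 2 * besselK κ x := by
    have h0 := integral_comp_neg_Ioi 0 h
    rw [neg_zero] at h0
    rw [← intervalIntegral.integral_Iic_add_Ioi hhi.integrableOn hhi.integrableOn (b := 0), ← h0,
      ← integral_add hneg hhi.integrableOn, besselK, ← integral_const_mul]
    congr 1
    funext t
    simp only [hh]
    rw [cosh_neg, cosh_eq (κ * t), mul_neg]
    ring
  rw [hval, hsplit, rpow_neg (by positivity)]
  have : 0 < (x / 2) ^ κ := by positivity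
  field_simp

/-- The Matérn function as a scale mixture of Gaussians. -/
theorem matern_eq_integral {κ β r : ℝ} (hκ : 0 < κ) (hβ : 0 < β) (hr : 0 < r) :
    matern κ β r = 1 / Gamma κ *
      ∫ w in Ioi (0 : ℝ), w ^ (κ - 1) * exp (-w) * exp (-(r ^ 2 / (4 * β ^ 2) / w)) := by
  have hx : 0 < r / β := by positivity
  rw [matern, if_neg hr.ne', besselK_eq_integral hκ hx]
  rw [show (r / β) ^ 2 / 4 = r ^ 2 / (4 * β ^ 2) by field_simp]
  have e : (2 : ℝ) ^ (1 - κ) * (r / β) ^ κ * (1 / 2 * (r / β / 2) ^ (-κ)) = 1 := by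
    rw [rpow_neg (by positivity), div_rpow hx.le zero_le_two, rpow_sub two_pos, rpow_one]
    have h1 : 0 < (r / β) ^ κ := by positivity
    have h2 : (0 : ℝ) < 2 ^ κ := by positivity
    field_simp
  have hG : 0 < Gamma κ := Real.Gamma_pos_of_pos hκ
  linear_combination (1 / Gamma κ * ∫ w in Ioi (0 : ℝ),
    w ^ (κ - 1) * exp (-w) * exp (-(r ^ 2 / (4 * β ^ 2) / w))) * e

theorem measurable_matern (κ β : ℝ) : Measurable (matern κ β) := by
  have h : Measurable (besselK κ) := by
    have : StronglyMeasurable (Function.uncurry fun x t : ℝ => exp (-x * cosh t) * cosh (κ * t)) := by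
      apply Continuous.stronglyMeasurable
      simp only [Function.uncurry_def]
      fun_prop
    exact (this.integral_prod_right (ν := volume.restrict (Ioi 0))).measurable
  unfold matern
  refine Measurable.ite (measurableSet_singleton 0) measurable_const ?_
  exact Measurable.mul (by fun_prop) (h.comp (by fun_prop))

/-- In the mixture the Gaussian factor is at most 1, and without it the integral is `Gamma κ`. The
same majorant gives the limit at the origin. -/
theorem abs_matern_le_one {κ β r : ℝ} (hκ : 0 < κ) (hβ : 0 < β) (hr : 0 < r) :
    |matern κ β r| ≤ 1 := by
  have hG : 0 < Gamma κ := Real.Gamma_pos_of_pos hκ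
  have hnn : ∀ w ∈ Ioi (0 : ℝ), 0 ≤ w ^ (κ - 1) * exp (-w) * exp (-(r ^ 2 / (4 * β ^ 2) / w)) := by
    intro w hw
    have hw : 0 < w := hw
    positivity
  rw [matern_eq_integral hκ hβ hr, abs_mul, abs_of_pos (by positivity),
    abs_of_nonneg (setIntegral_nonneg measurableSet_Ioi hnn), one_div, inv_mul_le_one₀ hG,
    Real.Gamma_eq_integral hκ]
  refine setIntegral_mono_on (integrableOn_rpow_mul_exp_neg_mul_exp_neg_div hκ (by positivity))
    (Real.GammaIntegral_convergent hκ) measurableSet_Ioi fun w hw => ?_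
  have hw : 0 < w := hw
  rw [mul_comm (exp (-w))]
  refine mul_le_of_le_one_right (by positivity) ?_
  rw [exp_le_one_iff, neg_nonpos]
  positivity

theorem tendsto_matern {κ β : ℝ} (hκ : 0 < κ) (hβ : 0 < β) :
    Filter.Tendsto (matern κ β) (nhdsWithin 0 (Ioi 0)) (nhds 1) := by
  have hG : 0 < Gamma κ := Real.Gamma_pos_of_pos hκ
  have h : Filter.Tendsto (fun r : ℝ => 1 / Gamma κ *
      ∫ w in Ioi (0 : ℝ), w ^ (κ - 1) * exp (-w) * exp (-(r ^ 2 / (4 * β ^ 2) / w)))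
      (nhdsWithin 0 (Ioi 0)) (nhds (1 / Gamma κ * ∫ w in Ioi (0 : ℝ), exp (-w) * w ^ (κ - 1))) := by
    refine Filter.Tendsto.const_mul _ ?_
    refine tendsto_integral_filter_of_dominated_convergence _ (.of_forall fun r => ?_)
      (.of_forall fun r => ?_) (Real.GammaIntegral_convergent hκ) (ae_of_all _ fun w => ?_)
    · exact (integrableOn_rpow_mul_exp_neg_mul_exp_neg_div hκ (by positivity)).aestronglyMeasurable
    · filter_upwards [ae_restrict_mem measurableSet_Ioi] with w hw
      have hw : 0 < w := hw
      rw [norm_eq_abs, abs_of_nonneg (by positivity), mul_comm (exp (-w))]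
      refine mul_le_of_le_one_right (by positivity) ?_
      rw [exp_le_one_iff, neg_nonpos]
      positivity
    · have hc : Continuous fun r : ℝ =>
        w ^ (κ - 1) * exp (-w) * exp (-(r ^ 2 / (4 * β ^ 2) / w)) := by fun_prop
      have h := (hc.tendsto 0).mono_left (nhdsWithin_le_nhds (s := Ioi 0))
      simpa [mul_comm] using h
  rw [← Real.Gamma_eq_integral hκ, one_div_mul_cancel hG.ne'] at h
  refine h.congr' ?_
  filter_upwards [self_mem_nhdsWithin] with r hr
  rw [matern_eq_integral hκ hβ hr]

/-- Integrating in `u` first gives a Gaussian moment proportional to `w ^ (a + 1)`; what remains is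
the convergent integral for `Γ(κ + a + 1)`. -/
theorem integrable_prod_gaussian_mixture {a κ β : ℝ} (ha : -1 < a) (hκ : 0 < κ) (hβ : 0 < β) :
    Integrable (Function.uncurry fun u w : ℝ => u ^ (2 * a + 1) *
      (w ^ (κ - 1) * exp (-w) * exp (-(u ^ 2 / (4 * β ^ 2) / w))))
      ((volume.restrict (Ioi 0)).prod (volume.restrict (Ioi 0))) := by
  have hmom : ∀ w : ℝ, 0 < w →
      IntegrableOn (fun u : ℝ => u ^ (2 * a + 1) * exp (-(u ^ 2 / (4 * β ^ 2) / w))) (Ioi 0) ∧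
      ∫ u in Ioi (0 : ℝ), u ^ (2 * a + 1) * exp (-(u ^ 2 / (4 * β ^ 2) / w)) =
        1 / 2 * (4 * β ^ 2) ^ (a + 1) * w ^ (a + 1) * Gamma (a + 1) := by
    intro w hw
    have h := integrableOn_and_integral_rpow_mul_exp_neg_mul_sq (s := 2 * a + 2)
      (p := (4 * β ^ 2 * w)⁻¹) (by linarith) (by positivity)
    rw [show 2 * a + 2 - 1 = 2 * a + 1 by ring, show (2 * a + 2) / 2 = a + 1 by ring,
      inv_rpow (by positivity), rpow_neg (by positivity), inv_inv,
      mul_rpow (by positivity) hw.le, ← mul_assoc (1 / 2 : ℝ)] at h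
    have e : ∀ u : ℝ, -(4 * β ^ 2 * w)⁻¹ * u ^ 2 = -(u ^ 2 / (4 * β ^ 2) / w) := by
      intro u; field_simp
    simp_rw [e] at h
    exact h
  rw [integrable_prod_iff']
  · constructor
    · filter_upwards [ae_restrict_mem measurableSet_Ioi] with w hw
      refine ((hmom w hw).1.const_mul (w ^ (κ - 1) * exp (-w))).congr (ae_of_all _ fun u => ?_)
      simp only [Function.uncurry_apply_pair]
      ring
    · have h := (Real.GammaIntegral_convergent (s := κ + (a + 1)) (by linarith)).const_mul
        (1 / 2 * (4 * β ^ 2) ^ (a + 1) * Gamma (a + 1))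
      refine h.congr ?_
      filter_upwards [ae_restrict_mem measurableSet_Ioi] with w hw
      have hw : 0 < w := hw
      have e : ∫ u in Ioi (0 : ℝ), ‖Function.uncurry (fun u w : ℝ => u ^ (2 * a + 1) *
          (w ^ (κ - 1) * exp (-w) * exp (-(u ^ 2 / (4 * β ^ 2) / w)))) (u, w)‖ =
          w ^ (κ - 1) * exp (-w) *
            ∫ u in Ioi (0 : ℝ), u ^ (2 * a + 1) * exp (-(u ^ 2 / (4 * β ^ 2) / w)) := by
        rw [← integral_const_mul]
        refine setIntegral_congr_fun measurableSet_Ioi fun u hu => ?_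
        have hu : 0 < u := hu
        simp only [Function.uncurry_apply_pair]
        rw [norm_eq_abs, abs_of_nonneg (by positivity)]
        ring
      rw [e, (hmom w hw).2, show κ + (a + 1) - 1 = (κ - 1) + (a + 1) by ring, rpow_add hw]
      ring
  · apply Measurable.aestronglyMeasurable
    simp only [Function.uncurry_def]
    fun_prop

theorem integrableOn_rpow_mul_matern {a κ β : ℝ} (ha : -1 < a) (hκ : 0 < κ) (hβ : 0 < β) :
    IntegrableOn (fun u => u ^ (2 * a + 1) * matern κ β u) (Ioi 0) := by
  have h := (integrable_prod_gaussian_mixture ha hκ hβ).integral_prod_left.const_mul (1 / Gamma κ)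
  refine IntegrableOn.congr_fun h (fun u hu => ?_) measurableSet_Ioi
  simp only [Function.uncurry_apply_pair]
  rw [matern_eq_integral hκ hβ hu, integral_const_mul]
  ring

/-- After exchanging integrals, the Hankel transform of each Gaussian contributes `exp (-β ^ 2 * z ^
2 * w)`, which joins `exp (-w)` in a Gamma integral of rate `1 + β ^ 2 * z ^ 2`. -/
theorem spectralDensity_matern {d : ℕ} (hd : 1 ≤ d) {κ β z : ℝ} (hκ : 0 < κ) (hβ : 0 < β)
    (hz : 0 < z) : spectralDensity d (matern κ β) z = maternSpectral d κ β z := by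
  have hd' : (1 : ℝ) ≤ d := by exact_mod_cast hd
  rw [spectralDensity_eq_integral_besselSeries d _ hz]
  set a : ℝ := (d : ℝ) / 2 - 1 with ha_def
  have ha : -1 / 2 ≤ a := by linarith
  have ha1 : -1 < a := by linarith
  have hG : 0 < Gamma κ := Real.Gamma_pos_of_pos hκ
  obtain ⟨C, -, hC⟩ := exists_abs_besselSeries_le ha
  have hprod : Integrable (Function.uncurry fun u w : ℝ => besselSeries a (u * z) *
      (u ^ (2 * a + 1) * (w ^ (κ - 1) * exp (-w) * exp (-(u ^ 2 / (4 * β ^ 2) / w)))))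
      ((volume.restrict (Ioi 0)).prod (volume.restrict (Ioi 0))) := by
    refine (integrable_prod_gaussian_mixture ha1 hκ hβ).bdd_mul
      (f := fun x : ℝ × ℝ => besselSeries a (x.1 * z)) (c := C) ?_ (ae_of_all _ fun x => hC _)
    exact ((measurable_besselSeries ha1).comp (by fun_prop)).aestronglyMeasurable
  have hswap := integral_integral_swap hprod
  have hb : 0 < 1 + β ^ 2 * z ^ 2 := by positivity
  have h1 : ∫ u in Ioi (0 : ℝ), u ^ (2 * a + 1) * besselSeries a (u * z) * matern κ β u =
      1 / Gamma κ * ∫ u in Ioi (0 : ℝ), ∫ w in Ioi (0 : ℝ), besselSeries a (u * z) *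
      (u ^ (2 * a + 1) * (w ^ (κ - 1) * exp (-w) * exp (-(u ^ 2 / (4 * β ^ 2) / w)))) := by
    rw [← integral_const_mul]
    refine setIntegral_congr_fun measurableSet_Ioi fun u hu => ?_
    rw [integral_const_mul, integral_const_mul, matern_eq_integral hκ hβ hu]
    ring
  have h2 : ∫ w in Ioi (0 : ℝ), ∫ u in Ioi (0 : ℝ), besselSeries a (u * z) *
      (u ^ (2 * a + 1) * (w ^ (κ - 1) * exp (-w) * exp (-(u ^ 2 / (4 * β ^ 2) / w)))) =
      1 / 2 * (4 * β ^ 2) ^ (a + 1) *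
        ∫ w in Ioi (0 : ℝ), w ^ (κ + (a + 1) - 1) * exp (-((1 + β ^ 2 * z ^ 2) * w)) := by
    rw [← integral_const_mul]
    refine setIntegral_congr_fun measurableSet_Ioi fun w hw => ?_
    have hw : 0 < w := hw
    have h := integral_rpow_mul_besselSeries_mul_exp_neg_mul_sq ha1
      (p := (4 * β ^ 2 * w)⁻¹) (by positivity) z
    rw [inv_rpow (by positivity), rpow_neg (by positivity), inv_inv,
      mul_rpow (by positivity) hw.le] at h
    have e : ∀ u : ℝ, -(4 * β ^ 2 * w)⁻¹ * u ^ 2 = -(u ^ 2 / (4 * β ^ 2) / w) := by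
      intro u; field_simp
    simp_rw [e] at h
    have e2 : exp (-((1 + β ^ 2 * z ^ 2) * w)) =
        exp (-w) * exp (-z ^ 2 / (4 * (4 * β ^ 2 * w)⁻¹)) := by
      rw [← exp_add]; congr 1; field_simp; ring
    rw [e2, show κ + (a + 1) - 1 = (κ - 1) + (a + 1) by ring, rpow_add hw]
    calc _ = w ^ (κ - 1) * exp (-w) * ∫ u in Ioi (0 : ℝ), u ^ (2 * a + 1) *
          besselSeries a (u * z) * exp (-(u ^ 2 / (4 * β ^ 2) / w)) := by
          rw [← integral_const_mul]
          congr 1; funext u; ring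
      _ = _ := by rw [h]; ring
  rw [h1, hswap, h2, Real.integral_rpow_mul_exp_neg_mul_Ioi (by linarith) hb, maternSpectral,
    show a + 1 = (d : ℝ) / 2 by linarith, one_div (1 + _), inv_rpow hb.le, neg_div, rpow_neg pi_pos.le,
    rpow_sub two_pos, rpow_one, show 4 * β ^ 2 = (2 * β) ^ 2 by ring, ← rpow_natCast (2 * β) 2,
    ← rpow_mul (by positivity), show ((2 : ℕ) : ℝ) * ((d : ℝ) / 2) = d by push_cast; ring,
    mul_rpow zero_le_two hβ.le, rpow_natCast β]
  have p1 : (0 : ℝ) < 2 ^ (d : ℝ) := by positivity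
  have p2 : (0 : ℝ) < π ^ ((d : ℝ) / 2) := by positivity
  have p3 : 0 < (1 + β ^ 2 * z ^ 2) ^ (κ + (d : ℝ) / 2) := by positivity
  field_simp

theorem integrableOn_pow_mul_maternSpectral {d : ℕ} (hd : 1 ≤ d) {κ β : ℝ} (hκ : 1 / 2 ≤ κ)
    (hβ : 0 < β) : IntegrableOn (fun z => z ^ (d - 1) * maternSpectral d κ β z) (Ioi 0) := by
  have hd' : (1 : ℝ) ≤ d := by exact_mod_cast hd
  set A : ℝ := Gamma (κ + d / 2) / (π ^ ((d : ℝ) / 2) * Gamma κ) with hA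
  have hi : Integrable fun z : ℝ => |A| * β * (1 + (β * z) ^ 2)⁻¹ :=
    (integrable_inv_one_add_sq.comp_mul_left' hβ.ne').const_mul _
  refine Integrable.mono' (hi.integrableOn (s := Ioi 0)) ?_ ?_
  · apply Measurable.aestronglyMeasurable
    unfold maternSpectral
    fun_prop
  · filter_upwards [ae_restrict_mem measurableSet_Ioi] with z hz
    have hz : 0 < z := hz
    have hb1 : 1 ≤ 1 + (β * z) ^ 2 := by nlinarith [sq_nonneg (β * z)]
    have hb : 0 < 1 + (β * z) ^ 2 := by positivity
    have h1 : (β * z) ^ (d - 1) ≤ (1 + (β * z) ^ 2) ^ (((d : ℝ) - 1) / 2) := by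
      have e : (β * z) ^ (d - 1) = ((β * z) ^ 2) ^ (((d : ℝ) - 1) / 2) := by
        rw [← rpow_natCast (β * z) 2, ← rpow_mul (by positivity), ← rpow_natCast, Nat.cast_sub hd]
        congr 1; push_cast; ring
      rw [e]
      exact rpow_le_rpow (by positivity) (by linarith) (by linarith)
    -- The exponents differ by `-(κ + 1/2)`, which is at most `-1` exactly when `κ ≥ 1/2`.
    have h2 : (1 + (β * z) ^ 2) ^ (((d : ℝ) - 1) / 2) / (1 + (β * z) ^ 2) ^ (κ + (d : ℝ) / 2) ≤
        (1 + (β * z) ^ 2)⁻¹ := by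
      rw [← rpow_sub hb, ← rpow_neg_one]
      exact rpow_le_rpow_of_exponent_le hb1 (by linarith)
    rw [maternSpectral, ← hA, ← mul_pow]
    have e : z ^ (d - 1) * (A * (β ^ d / (1 + (β * z) ^ 2) ^ (κ + (d : ℝ) / 2))) =
        A * (β * ((β * z) ^ (d - 1) / (1 + (β * z) ^ 2) ^ (κ + (d : ℝ) / 2))) := by
      rw [mul_pow]
      obtain ⟨n, rfl⟩ : ∃ n, d = n + 1 := ⟨d - 1, by omega⟩
      rw [Nat.add_sub_cancel, pow_succ]
      ring
    rw [e, norm_mul, norm_eq_abs, norm_eq_abs, abs_of_nonneg (a := β * _) (by positivity),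
      mul_assoc |A|]
    gcongr
    refine le_trans ?_ h2
    gcongr

/-! ### The generalized Wendland function and its Mellin transform. -/

theorem integrableOn_and_integral_rpow_mul_max_one_sub {s μ : ℝ} (hs : 0 < s) (hμ : 0 < μ) :
    IntegrableOn (fun x : ℝ => x ^ (s - 1) * (max 0 (1 - x)) ^ μ) (Ioi 0) ∧
    ∫ x in Ioi (0 : ℝ), x ^ (s - 1) * (max 0 (1 - x)) ^ μ =
      Gamma s * Gamma (μ + 1) / Gamma (s + (μ + 1)) := by
  have hi := integrableOn_beta hs (t := μ + 1) (by linarith)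
  have hv := integral_beta hs (t := μ + 1) (by linarith)
  have hind : (fun x : ℝ => x ^ (s - 1) * (max 0 (1 - x)) ^ μ) =
      (Iio 1).indicator (fun x : ℝ => x ^ (s - 1) * (1 - x) ^ (μ + 1 - 1)) := by
    funext x
    by_cases hx : x < 1
    · rw [indicator_of_mem (show x ∈ Iio 1 from hx), max_eq_right (by linarith),
        add_sub_cancel_right]
    · rw [indicator_of_notMem (show x ∉ Iio 1 from hx), max_eq_left (by linarith),
        zero_rpow hμ.ne', mul_zero]
  rw [hind]
  constructor
  · rw [IntegrableOn, integrable_indicator_iff measurableSet_Iio, IntegrableOn,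
      Measure.restrict_restrict measurableSet_Iio, inter_comm, Ioi_inter_Iio]
    exact hi
  · rw [setIntegral_indicator measurableSet_Iio, Ioi_inter_Iio]
    exact hv

theorem integrableOn_and_integral_rpow_mul_sq_sub_sq {s t u : ℝ} (hs : 0 < s) (ht : 0 < t)
    (hu : 0 < u) :
    IntegrableOn (fun r : ℝ => r ^ (s - 1) * (Iio u).indicator
      (fun r => (u ^ 2 - r ^ 2) ^ (t - 1)) r) (Ioi 0) ∧
    ∫ r in Ioi (0 : ℝ), r ^ (s - 1) * (Iio u).indicator (fun r => (u ^ 2 - r ^ 2) ^ (t - 1)) r =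
      u ^ (s + 2 * t - 2) * (1 / 2 * (Gamma (s / 2) * Gamma t / Gamma (s / 2 + t))) := by
  set g : ℝ → ℝ := fun x => x ^ (s - 1) * (Iio 1).indicator (fun x => (1 - x ^ 2) ^ (t - 1)) x
    with hg
  have h := integrableOn_and_integral_rpow_mul_one_sub_sq hs ht
  have hu' : 0 < u⁻¹ := by positivity
  have hcongr : ∀ r ∈ Ioi (0 : ℝ), r ^ (s - 1) * (Iio u).indicator
      (fun r => (u ^ 2 - r ^ 2) ^ (t - 1)) r = u ^ (s + 2 * t - 2 - 1) * g (u⁻¹ * r) := by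
    intro r hr
    have hr : 0 < r := hr
    have hx : 0 < u⁻¹ * r := by positivity
    have e : r = u * (u⁻¹ * r) := by field_simp
    by_cases hru : r < u
    · have hx1 : u⁻¹ * r < 1 := by rwa [inv_mul_lt_one₀ hu]
      rw [hg]
      simp only
      rw [indicator_of_mem (show r ∈ Iio u from hru),
        indicator_of_mem (show u⁻¹ * r ∈ Iio 1 from hx1)]
      generalize u⁻¹ * r = x at e hx hx1
      rw [e, show u ^ 2 - (u * x) ^ 2 = u ^ 2 * (1 - x ^ 2) by ring,
        mul_rpow hu.le hx.le, mul_rpow (by positivity) (by nlinarith),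
        show s + 2 * t - 2 - 1 = (s - 1) + ((2 : ℕ) : ℝ) * (t - 1) by push_cast; ring, rpow_add hu,
        rpow_mul hu.le, rpow_natCast]
      ring
    · have hx1 : ¬ u⁻¹ * r < 1 := by rwa [inv_mul_lt_one₀ hu]
      rw [hg]
      simp only
      rw [indicator_of_notMem (show r ∉ Iio u from hru),
        indicator_of_notMem (show u⁻¹ * r ∉ Iio 1 from hx1)]
      ring
  constructor
  · rw [integrableOn_congr_fun hcongr measurableSet_Ioi]
    refine Integrable.const_mul ?_ _
    have h2 := (integrableOn_Ioi_comp_mul_left_iff g 0 hu').mpr (by rw [mul_zero]; exact h.1)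
    exact h2
  · rw [setIntegral_congr_fun measurableSet_Ioi hcongr, integral_const_mul,
      integral_comp_mul_left_Ioi g 0 hu', mul_zero, h.2, inv_inv, smul_eq_mul,
      rpow_sub_one hu.ne']
    field_simp

/-- The generalized Wendland function with unit support, in a form that is continuous at the
origin. -/
noncomputable def wendlandProfile (ν μ r : ℝ) : ℝ :=
  if ν = 0 then (max 0 (1 - r)) ^ μ
  else 1 / ProbabilityTheory.beta (2 * ν) (μ + 1) *
    ∫ w in Ioi (0 : ℝ), w ^ (2 * ν - 1) * (max 0 (1 - √(w ^ 2 + r ^ 2))) ^ μ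

/-- The substitution is `u = √(w ^ 2 + r ^ 2)`. In the variable `w` the domain does not depend on
`r` and the integrand is largest at `r = 0`, so the bound by 1 and the limit at the origin follow
from one Beta majorant; the variable `u` suits the Mellin transform. -/
theorem wendlandProfile_eq_integral_Ioi {ν μ r : ℝ} (hν : 0 < ν) (hr : 0 < r) :
    wendlandProfile ν μ r = 1 / ProbabilityTheory.beta (2 * ν) (μ + 1) *
      ∫ u in Ioi r, u * (u ^ 2 - r ^ 2) ^ (ν - 1) * (max 0 (1 - u)) ^ μ := by
  rw [wendlandProfile, if_neg hν.ne']
  congr 1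
  have himg : (fun w => √(w ^ 2 + r ^ 2)) '' Ioi 0 = Ioi r := by
    ext u
    simp only [mem_image, mem_Ioi]
    constructor
    · rintro ⟨w, hw, rfl⟩
      exact lt_sqrt_of_sq_lt (by nlinarith)
    · intro hu
      refine ⟨√(u ^ 2 - r ^ 2), sqrt_pos.mpr (by nlinarith), ?_⟩
      rw [sq_sqrt (by nlinarith), sub_add_cancel, sqrt_sq (by linarith)]
  have hderiv : ∀ w ∈ Ioi (0 : ℝ),
      HasDerivWithinAt (fun w => √(w ^ 2 + r ^ 2)) (w / √(w ^ 2 + r ^ 2)) (Ioi 0) w := by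
    intro w _
    have h1 : HasDerivAt (fun w : ℝ => w ^ 2 + r ^ 2) (2 * w) w := by
      simpa using (hasDerivAt_pow 2 w).add_const (r ^ 2)
    have h2 := (h1.sqrt (by positivity)).hasDerivWithinAt (s := Ioi 0)
    rwa [mul_div_mul_left _ _ two_ne_zero] at h2
  have hinj : InjOn (fun w => √(w ^ 2 + r ^ 2)) (Ioi 0) := by
    intro w hw v hv hwv
    have h := (sqrt_inj (by positivity) (by positivity)).mp hwv
    exact (pow_left_inj₀ (mem_Ioi.mp hw).le (mem_Ioi.mp hv).le two_ne_zero).mp (by linarith)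
  rw [← himg, integral_image_eq_integral_abs_deriv_smul measurableSet_Ioi hderiv hinj]
  refine setIntegral_congr_fun measurableSet_Ioi fun w hw => ?_
  have hw : 0 < w := hw
  have hs : 0 < √(w ^ 2 + r ^ 2) := sqrt_pos.mpr (by positivity)
  simp only [smul_eq_mul]
  rw [abs_of_pos (by positivity), sq_sqrt (by positivity), add_sub_cancel_right,
    ← rpow_natCast w 2, ← rpow_mul hw.le,
    show 2 * ν - 1 = 1 + ((2 : ℕ) : ℝ) * (ν - 1) by push_cast; ring, rpow_add hw, rpow_one]
  field_simp

theorem generalizedWendland_eq_wendlandProfile {ν μ δ r : ℝ} (hν : 0 ≤ ν) (hμ : 0 < μ)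
    (hδ : 0 < δ) (hr : 0 < r) :
    generalizedWendland ν μ δ r = wendlandProfile ν μ (r / δ) := by
  have hx : 0 < r / δ := by positivity
  have hle : r ≤ δ ↔ r / δ ≤ 1 := (div_le_one hδ).symm
  rw [generalizedWendland]
  simp only [hle]
  generalize r / δ = x at hx
  rcases hν.eq_or_lt with rfl | hν
  · rw [wendlandProfile, if_pos rfl, if_pos rfl]
    split_ifs with h
    · rw [max_eq_right (by linarith)]
    · rw [max_eq_left (by linarith), zero_rpow hμ.ne']
  · rw [wendlandProfile_eq_integral_Ioi hν hx, if_neg hν.ne']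
    split_ifs with h
    · congr 1
      rw [intervalIntegral.integral_of_le h]
      have h1 : ∫ u in Ioi x, u * (u ^ 2 - x ^ 2) ^ (ν - 1) * (max 0 (1 - u)) ^ μ =
          ∫ u in Ioc x 1, u * (u ^ 2 - x ^ 2) ^ (ν - 1) * (max 0 (1 - u)) ^ μ := by
        refine setIntegral_eq_of_subset_of_forall_sdiff_eq_zero measurableSet_Ioi
          (fun u hu => hu.1) fun u hu => ?_
        have : 1 < u := by
          by_contra hu1
          exact hu.2 ⟨hu.1, not_lt.mp hu1⟩
        rw [max_eq_left (by linarith), zero_rpow hμ.ne', mul_zero]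
      rw [h1]
      refine setIntegral_congr_fun measurableSet_Ioc fun u hu => ?_
      rw [max_eq_right (by linarith [hu.2])]
    · rw [setIntegral_eq_zero_of_forall_eq_zero, mul_zero]
      intro u hu
      have hu : x < u := hu
      rw [max_eq_left (by linarith), zero_rpow hμ.ne', mul_zero]

theorem measurable_wendlandProfile (ν μ : ℝ) : Measurable (wendlandProfile ν μ) := by
  by_cases hν : ν = 0
  · have : wendlandProfile ν μ = fun r => (max 0 (1 - r)) ^ μ := by
      funext r; rw [wendlandProfile, if_pos hν]
    rw [this]
    fun_prop
  · have : wendlandProfile ν μ = fun r => 1 / ProbabilityTheory.beta (2 * ν) (μ + 1) *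
        ∫ w in Ioi (0 : ℝ), w ^ (2 * ν - 1) * (max 0 (1 - √(w ^ 2 + r ^ 2))) ^ μ := by
      funext r; rw [wendlandProfile, if_neg hν]
    rw [this]
    have h : StronglyMeasurable (Function.uncurry fun r w : ℝ =>
        w ^ (2 * ν - 1) * (max 0 (1 - √(w ^ 2 + r ^ 2))) ^ μ) := by
      apply Measurable.stronglyMeasurable
      simp only [Function.uncurry_def]
      fun_prop
    exact (h.integral_prod_right (ν := volume.restrict (Ioi 0))).measurable.const_mul _

theorem wendlandProfile_kernel_le {ν μ : ℝ} (hμ : 0 < μ) (r : ℝ) {w : ℝ} (hw : 0 < w) :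
    w ^ (2 * ν - 1) * (max 0 (1 - √(w ^ 2 + r ^ 2))) ^ μ ≤
      w ^ (2 * ν - 1) * (max 0 (1 - w)) ^ μ := by
  have h : w ≤ √(w ^ 2 + r ^ 2) := le_sqrt_of_sq_le (by nlinarith [sq_nonneg r])
  gcongr

theorem wendlandProfile_kernel_nonneg {ν μ : ℝ} (r : ℝ) {w : ℝ} (hw : 0 < w) :
    0 ≤ w ^ (2 * ν - 1) * (max 0 (1 - √(w ^ 2 + r ^ 2))) ^ μ := by
  positivity

theorem beta_mul_integral_eq_one {ν μ : ℝ} (hν : 0 < ν) (hμ : 0 < μ) :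
    1 / ProbabilityTheory.beta (2 * ν) (μ + 1) *
      ∫ w in Ioi (0 : ℝ), w ^ (2 * ν - 1) * (max 0 (1 - w)) ^ μ = 1 := by
  have hB : 0 < ProbabilityTheory.beta (2 * ν) (μ + 1) :=
    ProbabilityTheory.beta_pos (by positivity) (by positivity)
  rw [(integrableOn_and_integral_rpow_mul_max_one_sub (s := 2 * ν) (by positivity) hμ).2,
    ← ProbabilityTheory.beta, one_div_mul_cancel hB.ne']

theorem wendlandProfile_nonneg {ν μ : ℝ} (hν : 0 ≤ ν) (hμ : 0 < μ) (r : ℝ) :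
    0 ≤ wendlandProfile ν μ r := by
  rcases hν.eq_or_lt with rfl | hν
  · rw [wendlandProfile, if_pos rfl]
    positivity
  · rw [wendlandProfile, if_neg hν.ne']
    have hB : 0 < ProbabilityTheory.beta (2 * ν) (μ + 1) :=
      ProbabilityTheory.beta_pos (by positivity) (by positivity)
    exact mul_nonneg (by positivity)
      (setIntegral_nonneg measurableSet_Ioi fun w hw => wendlandProfile_kernel_nonneg r hw)

theorem wendlandProfile_le_one {ν μ r : ℝ} (hν : 0 ≤ ν) (hμ : 0 < μ) (hr : 0 ≤ r) :
    wendlandProfile ν μ r ≤ 1 := by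
  rcases hν.eq_or_lt with rfl | hν
  · rw [wendlandProfile, if_pos rfl]
    exact rpow_le_one (le_max_left 0 (1 - r)) (max_le zero_le_one (by linarith)) hμ.le
  · rw [wendlandProfile, if_neg hν.ne']
    have hB : 0 < ProbabilityTheory.beta (2 * ν) (μ + 1) :=
      ProbabilityTheory.beta_pos (by positivity) (by positivity)
    refine (mul_le_mul_of_nonneg_left ?_ (by positivity)).trans (beta_mul_integral_eq_one hν hμ).le
    refine integral_mono_of_nonneg ?_
      (integrableOn_and_integral_rpow_mul_max_one_sub (s := 2 * ν) (by positivity) hμ).1 ?_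
    · filter_upwards [ae_restrict_mem measurableSet_Ioi] with w hw using
        wendlandProfile_kernel_nonneg r hw
    · filter_upwards [ae_restrict_mem measurableSet_Ioi] with w hw using
        wendlandProfile_kernel_le hμ r hw

theorem tendsto_wendlandProfile {ν μ : ℝ} (hν : 0 ≤ ν) (hμ : 0 < μ) :
    Filter.Tendsto (wendlandProfile ν μ) (nhds 0) (nhds 1) := by
  rcases hν.eq_or_lt with rfl | hν
  · have h : Continuous fun r : ℝ => (max 0 (1 - r)) ^ μ :=
      Continuous.rpow_const (by fun_prop) fun _ => Or.inr hμ.le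
    have h2 := h.tendsto 0
    simp only [sub_zero, zero_le_one, max_eq_right, one_rpow] at h2
    refine h2.congr fun r => ?_
    rw [wendlandProfile, if_pos rfl]
  · rw [← beta_mul_integral_eq_one hν hμ]
    have h : Filter.Tendsto (fun r : ℝ => 1 / ProbabilityTheory.beta (2 * ν) (μ + 1) *
        ∫ w in Ioi (0 : ℝ), w ^ (2 * ν - 1) * (max 0 (1 - √(w ^ 2 + r ^ 2))) ^ μ) (nhds 0)
        (nhds (1 / ProbabilityTheory.beta (2 * ν) (μ + 1) *
          ∫ w in Ioi (0 : ℝ), w ^ (2 * ν - 1) * (max 0 (1 - w)) ^ μ)) := by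
      refine Filter.Tendsto.const_mul _ ?_
      refine tendsto_integral_filter_of_dominated_convergence _ (.of_forall fun r => ?_)
        (.of_forall fun r => ?_)
        (integrableOn_and_integral_rpow_mul_max_one_sub (s := 2 * ν) (by positivity) hμ).1 ?_
      · exact Measurable.aestronglyMeasurable (by fun_prop)
      · filter_upwards [ae_restrict_mem measurableSet_Ioi] with w hw
        rw [norm_eq_abs, abs_of_nonneg (wendlandProfile_kernel_nonneg r hw)]
        exact wendlandProfile_kernel_le hμ r hw
      · filter_upwards [ae_restrict_mem measurableSet_Ioi] with w hw
        have hw : 0 < w := hw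
        have hc : Continuous fun r : ℝ =>
            w ^ (2 * ν - 1) * (max 0 (1 - √(w ^ 2 + r ^ 2))) ^ μ :=
          continuous_const.mul (Continuous.rpow_const (by fun_prop) fun _ => Or.inr hμ.le)
        have h2 := hc.tendsto 0
        simpa [sqrt_sq hw.le] using h2
    refine h.congr fun r => ?_
    rw [wendlandProfile, if_neg hν.ne']

/-- For `ν > 0`, Tonelli applies to a nonnegative kernel: the `r`-integral is a scaled Beta integral
producing `Γ(ν)`, the `u`-integral is another, and the normalization supplies `1 / Γ(2ν)`. For `ν =
0` a single Beta integral suffices, and the value 2 of `gammaRatio` cancels the factor `1 / 2`. -/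
theorem integrableOn_and_integral_rpow_mul_wendlandProfile {ν μ s : ℝ} (hν : 0 ≤ ν) (hμ : 0 < μ)
    (hs : 0 < s) :
    IntegrableOn (fun r => r ^ (s - 1) * wendlandProfile ν μ r) (Ioi 0) ∧
    ∫ r in Ioi (0 : ℝ), r ^ (s - 1) * wendlandProfile ν μ r =
      1 / 2 * gammaRatio ν * (Gamma (2 * ν + s) * Gamma (μ + 2 * ν + 1) * Gamma (s / 2) /
        (Gamma (μ + 2 * ν + s + 1) * Gamma (s / 2 + ν))) := by
  rcases hν.eq_or_lt with rfl | hν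
  · have h := integrableOn_and_integral_rpow_mul_max_one_sub hs hμ
    simp only [wendlandProfile, gammaRatio, if_true]
    refine ⟨h.1, h.2.trans ?_⟩
    have : 0 < Gamma (s / 2) := Real.Gamma_pos_of_pos (by positivity)
    simp only [mul_zero, add_zero, zero_add]
    rw [show s + (μ + 1) = μ + s + 1 by ring]
    field_simp
  · have hker := fun u (hu : 0 < u) => integrableOn_and_integral_rpow_mul_sq_sub_sq hs hν hu
    set k : ℝ → ℝ → ℝ := fun r u => u * (max 0 (1 - u)) ^ μ *
      (r ^ (s - 1) * (Iio u).indicator (fun r => (u ^ 2 - r ^ 2) ^ (ν - 1)) r) with hk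
    set c : ℝ := 1 / 2 * (Gamma (s / 2) * Gamma ν / Gamma (s / 2 + ν)) with hc
    have hinner : ∀ u, 0 < u → u * (max 0 (1 - u)) ^ μ * (u ^ (s + 2 * ν - 2) * c) =
        c * (u ^ (s + 2 * ν - 1) * (max 0 (1 - u)) ^ μ) := by
      intro u hu
      rw [show s + 2 * ν - 1 = 1 + (s + 2 * ν - 2) by ring, rpow_add hu, rpow_one]
      ring
    have hmax := integrableOn_and_integral_rpow_mul_max_one_sub (s := s + 2 * ν) (by positivity) hμ
    have hnn : ∀ r u, 0 < r → 0 < u → 0 ≤ k r u := by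
      intro r u hr hu
      have : 0 ≤ (Iio u).indicator (fun r => (u ^ 2 - r ^ 2) ^ (ν - 1)) r :=
        indicator_apply_nonneg fun hru => rpow_nonneg (by nlinarith [mem_Iio.mp hru]) _
      simp only [hk]
      positivity
    have hprod : Integrable (Function.uncurry k)
        ((volume.restrict (Ioi 0)).prod (volume.restrict (Ioi 0))) := by
      rw [integrable_prod_iff']
      · constructor
        · filter_upwards [ae_restrict_mem measurableSet_Ioi] with u hu
          exact (hker u hu).1.const_mul (u * (max 0 (1 - u)) ^ μ)
        · refine (hmax.1.const_mul c).congr ?_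
          filter_upwards [ae_restrict_mem measurableSet_Ioi] with u hu
          rw [← hinner u hu, ← (hker u hu).2, ← integral_const_mul]
          refine setIntegral_congr_fun measurableSet_Ioi fun r hr => ?_
          exact (abs_of_nonneg (hnn r u hr hu)).symm
      · apply Measurable.aestronglyMeasurable
        have hind : Measurable fun x : ℝ × ℝ => {x : ℝ × ℝ | x.1 < x.2}.indicator
            (fun x => (x.2 ^ 2 - x.1 ^ 2) ^ (ν - 1)) x :=
          Measurable.indicator (by fun_prop) (measurableSet_lt measurable_fst measurable_snd)
        have h1 : Measurable fun x : ℝ × ℝ => x.2 * (max 0 (1 - x.2)) ^ μ := by fun_prop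
        have h2 : Measurable fun x : ℝ × ℝ => x.1 ^ (s - 1) := by fun_prop
        exact h1.mul (h2.mul hind)
    have hout : ∀ r ∈ Ioi (0 : ℝ), 1 / ProbabilityTheory.beta (2 * ν) (μ + 1) *
        ∫ u in Ioi (0 : ℝ), k r u = r ^ (s - 1) * wendlandProfile ν μ r := by
      intro r hr
      have hr : 0 < r := hr
      rw [wendlandProfile_eq_integral_Ioi hν hr, mul_left_comm]
      congr 1
      rw [← integral_const_mul]
      have hsub : Ioi r ⊆ Ioi 0 := Ioi_subset_Ioi hr.le
      rw [setIntegral_eq_of_subset_of_forall_sdiff_eq_zero measurableSet_Ioi hsub]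
      · refine setIntegral_congr_fun measurableSet_Ioi fun u hu => ?_
        simp only [hk]
        rw [indicator_of_mem (show r ∈ Iio u from hu)]
        ring
      · intro u hu
        simp only [hk]
        rw [indicator_of_notMem (show r ∉ Iio u from hu.2), mul_zero, mul_zero]
    refine ⟨IntegrableOn.congr_fun (hprod.integral_prod_left.const_mul _) hout measurableSet_Ioi, ?_⟩
    rw [← setIntegral_congr_fun measurableSet_Ioi hout, integral_const_mul,
      integral_integral_swap hprod]
    have hcomp : ∫ u in Ioi (0 : ℝ), ∫ r in Ioi (0 : ℝ), k r u =
        c * (Gamma (s + 2 * ν) * Gamma (μ + 1) / Gamma (s + 2 * ν + (μ + 1))) := by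
      rw [← hmax.2, ← integral_const_mul]
      refine setIntegral_congr_fun measurableSet_Ioi fun u hu => ?_
      simp only [hk]
      rw [integral_const_mul, (hker u hu).2, hinner u hu]
    have g1 : 0 < Gamma (μ + 1) := Real.Gamma_pos_of_pos (by positivity)
    have g2 : 0 < Gamma (2 * ν) := Real.Gamma_pos_of_pos (by positivity)
    have g3 : 0 < Gamma (s / 2 + ν) := Real.Gamma_pos_of_pos (by positivity)
    have g4 : 0 < Gamma (μ + 2 * ν + s + 1) := Real.Gamma_pos_of_pos (by positivity)
    rw [hcomp, hc, gammaRatio, if_neg hν.ne', ProbabilityTheory.beta,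
      show s + 2 * ν + (μ + 1) = μ + 2 * ν + s + 1 by ring,
      show 2 * ν + (μ + 1) = μ + 2 * ν + 1 by ring, add_comm s (2 * ν)]
    field_simp

/-! ### The hypergeometric form of the Wendland spectral density. -/

theorem ascPochhammer_eval_pos {x : ℝ} (hx : 0 < x) (k : ℕ) : 0 < (ascPochhammer ℝ k).eval x :=
  (lt_min one_pos hx).trans_le (min_one_le_ascPochhammer_eval hx k)

theorem ascPochhammer_eval_le {x y : ℝ} (hx : 0 < x) (hxy : x ≤ y) (k : ℕ) :
    (ascPochhammer ℝ k).eval x ≤ (ascPochhammer ℝ k).eval y := by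
  induction k with
  | zero => simp
  | succ k ih =>
    rw [ascPochhammer_succ_eval, ascPochhammer_succ_eval]
    have := ascPochhammer_eval_pos (hx.trans_le hxy) k
    gcongr

theorem summable_hypergeometric1F2 {a b c : ℝ} (ha : 0 < a) (hb : a ≤ b) (hc : 1 ≤ c) (x : ℝ) :
    Summable fun k : ℕ => (ascPochhammer ℝ k).eval a /
      ((ascPochhammer ℝ k).eval b * (ascPochhammer ℝ k).eval c) *
        (x ^ k / (Nat.factorial k : ℝ)) := by
  refine Summable.of_norm_bounded (Real.summable_pow_div_factorial |x|) fun k => ?_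
  have h1 := ascPochhammer_eval_pos ha k
  have h2 := ascPochhammer_eval_le ha hb k
  have h3 : 1 ≤ (ascPochhammer ℝ k).eval c := by
    simpa [hc] using min_one_le_ascPochhammer_eval (by linarith : 0 < c) k
  have h4 := h1.trans_le h2
  rw [norm_mul, norm_div (x ^ k), norm_pow, norm_eq_abs, norm_eq_abs, norm_eq_abs, Nat.abs_cast]
  refine mul_le_of_le_one_left (by positivity) ?_
  rw [abs_of_pos (by positivity), div_le_one (by positivity)]
  nlinarith

theorem integrableOn_and_integral_rpow_mul_wendlandProfile_div {ν μ s δ : ℝ} (hν : 0 ≤ ν)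
    (hμ : 0 < μ) (hs : 0 < s) (hδ : 0 < δ) :
    IntegrableOn (fun r => r ^ (s - 1) * wendlandProfile ν μ (r / δ)) (Ioi 0) ∧
    ∫ r in Ioi (0 : ℝ), r ^ (s - 1) * wendlandProfile ν μ (r / δ) =
      δ ^ s * (1 / 2 * gammaRatio ν * (Gamma (2 * ν + s) * Gamma (μ + 2 * ν + 1) * Gamma (s / 2) /
        (Gamma (μ + 2 * ν + s + 1) * Gamma (s / 2 + ν)))) := by
  have h := integrableOn_and_integral_rpow_mul_wendlandProfile hν hμ hs
  set g : ℝ → ℝ := fun r => r ^ (s - 1) * wendlandProfile ν μ r with hg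
  have hδ' : 0 < δ⁻¹ := by positivity
  have hcongr : ∀ r ∈ Ioi (0 : ℝ), r ^ (s - 1) * wendlandProfile ν μ (r / δ) =
      δ ^ (s - 1) * g (δ⁻¹ * r) := by
    intro r hr
    have hr : 0 < r := hr
    rw [hg]
    simp only
    rw [mul_rpow (by positivity) hr.le, inv_rpow hδ.le, div_eq_inv_mul]
    have : 0 < δ ^ (s - 1) := by positivity
    field_simp
  constructor
  · rw [integrableOn_congr_fun hcongr measurableSet_Ioi]
    refine Integrable.const_mul ?_ _
    exact (integrableOn_Ioi_comp_mul_left_iff g 0 hδ').mpr (by rw [mul_zero]; exact h.1)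
  · rw [setIntegral_congr_fun measurableSet_Ioi hcongr, integral_const_mul,
      integral_comp_mul_left_Ioi g 0 hδ', mul_zero, h.2, inv_inv, smul_eq_mul,
      rpow_sub_one hδ.ne']
    field_simp

theorem spectralDensity_wendlandProfile {d : ℕ} (hd : 1 ≤ d) {ν μ δ z : ℝ} (hν : 0 ≤ ν)
    (hμ : 0 < μ) (hδ : 0 < δ) (hz : 0 < z) :
    spectralDensity d (fun u => wendlandProfile ν μ (u / δ)) z =
      generalizedWendlandSpectral d ν μ δ z := by
  have hd' : (1 : ℝ) ≤ d := by exact_mod_cast hd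
  set L : ℝ := wendlandLambda d ν with hL
  have hLd : L = ((d : ℝ) + 1) / 2 + ν := by rw [hL, wendlandLambda]
  have hL1 : 1 ≤ L := by rw [hLd]; linarith
  rw [spectralDensity_eq_integral_besselSeries d _ hz]
  set A : ℝ := δ ^ d * (1 / 2 * gammaRatio ν * (Gamma (2 * ν + d) * Gamma (μ + 2 * ν + 1) /
    (Gamma (μ + 2 * ν + d + 1) * Gamma (ν + d / 2)))) with hA
  have hmom : ∀ k : ℕ, IntegrableOn (fun u : ℝ => u ^ (2 * ((d : ℝ) / 2 - 1) + 1 + 2 * k) *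
        wendlandProfile ν μ (u / δ)) (Ioi 0) ∧
      ∫ u in Ioi (0 : ℝ), u ^ (2 * ((d : ℝ) / 2 - 1) + 1 + 2 * k) * wendlandProfile ν μ (u / δ) =
      A * (Gamma (k + ((d : ℝ) / 2 - 1) + 1) * ((δ ^ 2) ^ k * ((ascPochhammer ℝ k).eval L /
        ((ascPochhammer ℝ k).eval (L + μ / 2) * (ascPochhammer ℝ k).eval (L + (μ + 1) / 2))))) := by
    intro k
    have h := integrableOn_and_integral_rpow_mul_wendlandProfile_div (s := d + 2 * k) hν hμ
      (by positivity) hδ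
    rw [show (d : ℝ) + 2 * k - 1 = 2 * ((d : ℝ) / 2 - 1) + 1 + 2 * k by ring] at h
    refine ⟨h.1, h.2.trans ?_⟩
    -- Duplication splits both Gamma quotients; the powers of 4 cancel, and the factor `(ν + d/2)_k`
    -- cancels against `Γ(s/2 + ν)` at `s = d + 2k`. The three surviving symbols are the parameters
    -- of the `₁F₂`.
    have g1 := Gamma_add_two_mul (x := 2 * ν + d) (by positivity) k
    have g2 := Gamma_add_two_mul (x := μ + 2 * ν + d + 1) (by positivity) k
    have g3 := ascPochhammer_eval_mul_Gamma (x := ν + d / 2) (by positivity) k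
    rw [show (2 * ν + (d : ℝ)) / 2 = ν + d / 2 by ring,
      show (2 * ν + (d : ℝ) + 1) / 2 = L by rw [hLd]; ring] at g1
    rw [show (μ + 2 * ν + (d : ℝ) + 1) / 2 = L + μ / 2 by rw [hLd]; ring,
      show (μ + 2 * ν + (d : ℝ) + 1 + 1) / 2 = L + (μ + 1) / 2 by rw [hLd]; ring] at g2
    have e : δ ^ ((d : ℝ) + 2 * k) = δ ^ d * (δ ^ 2) ^ k := by
      rw [rpow_add hδ, rpow_natCast, ← pow_mul, ← rpow_natCast δ (2 * k)]
      push_cast; rfl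
    rw [e, show 2 * ν + ((d : ℝ) + 2 * k) = 2 * ν + d + 2 * k by ring, g1,
      show μ + 2 * ν + ((d : ℝ) + 2 * k) + 1 = μ + 2 * ν + d + 1 + 2 * k by ring, g2,
      show ((d : ℝ) + 2 * k) / 2 + ν = ν + d / 2 + k by ring, ← g3,
      show ((d : ℝ) + 2 * k) / 2 = k + ((d : ℝ) / 2 - 1) + 1 by ring, hA]
    have p1 := ascPochhammer_eval_pos (x := ν + d / 2) (by positivity) k
    have p2 := ascPochhammer_eval_pos (x := L + μ / 2) (by positivity) k
    have p3 := ascPochhammer_eval_pos (x := L + (μ + 1) / 2) (by positivity) k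
    have p4 : 0 < Gamma (ν + (d : ℝ) / 2) := Real.Gamma_pos_of_pos (by positivity)
    have p5 : 0 < Gamma (μ + 2 * ν + d + 1) := Real.Gamma_pos_of_pos (by positivity)
    generalize (ascPochhammer ℝ k).eval (ν + d / 2) = q1 at *
    generalize (ascPochhammer ℝ k).eval (L + μ / 2) = q2 at *
    generalize (ascPochhammer ℝ k).eval (L + (μ + 1) / 2) = q3 at *
    generalize Gamma (ν + (d : ℝ) / 2) = q4 at *
    generalize Gamma (μ + 2 * ν + (d : ℝ) + 1) = q5 at *
    field_simp
  have hterm : ∀ (y : ℝ) (k : ℕ),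
      y ^ k / ((Nat.factorial k : ℝ) * Gamma (k + ((d : ℝ) / 2 - 1) + 1)) *
      (A * (Gamma (k + ((d : ℝ) / 2 - 1) + 1) * ((δ ^ 2) ^ k * ((ascPochhammer ℝ k).eval L /
        ((ascPochhammer ℝ k).eval (L + μ / 2) * (ascPochhammer ℝ k).eval (L + (μ + 1) / 2)))))) =
      A * ((ascPochhammer ℝ k).eval L /
        ((ascPochhammer ℝ k).eval (L + μ / 2) * (ascPochhammer ℝ k).eval (L + (μ + 1) / 2)) *
        ((y * δ ^ 2) ^ k / (Nat.factorial k : ℝ))) := by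
    intro y k
    have hk : (0 : ℝ) ≤ k := by positivity
    have p : 0 < Gamma (k + ((d : ℝ) / 2 - 1) + 1) := Real.Gamma_pos_of_pos (by linarith)
    generalize Gamma (k + ((d : ℝ) / 2 - 1) + 1) = q at *
    generalize (ascPochhammer ℝ k).eval L /
        ((ascPochhammer ℝ k).eval (L + μ / 2) * (ascPochhammer ℝ k).eval (L + (μ + 1) / 2)) = c
    rw [mul_pow]
    field_simp
  have hsumm := fun x => summable_hypergeometric1F2 (a := L) (b := L + μ / 2)
    (c := L + (μ + 1) / 2) (by linarith) (by linarith) (by linarith) x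
  have key := hasSum_integral_rpow_mul_besselSeries (a := (d : ℝ) / 2 - 1) (by linarith)
    (f := fun u => wendlandProfile ν μ (u / δ)) (fun u _ => wendlandProfile_nonneg hν hμ _) z
    (fun k => (hmom k).1) (by
      simp_rw [fun k => (hmom k).2, hterm]
      exact (hsumm _).mul_left _)
  simp_rw [fun k => (hmom k).2, hterm] at key
  rw [key.unique ((hsumm _).hasSum.mul_left A), generalizedWendlandSpectral, hypergeometric1F2, ← hL,
    show -(z / 2) ^ 2 * δ ^ 2 = -(z * δ) ^ 2 / 4 by ring, hA, sub_eq_add_neg 1 (d : ℝ),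
    rpow_add two_pos, rpow_one]
  ring

/-! ### Convolution identities and growth bounds for the Laplace series. -/

/-- The function with Laplace transform `s ^ (2 * l - r) * (1 + s ^ 2) ^ (-l)`. -/
noncomputable def laplaceSeries (l r x : ℝ) : ℝ :=
  ∑' k : ℕ, (-1) ^ k * ((ascPochhammer ℝ k).eval l / (Nat.factorial k : ℝ)) *
    (x ^ (r + 2 * k - 1) / Gamma (r + 2 * k))

/-- `Γ(r + 2k) / Γ(r)` splits by duplication into two products: one dominates `(l)_k` factor by
factor because `l ≤ r`, and the other has all factors at least 1. -/
theorem ascPochhammer_eval_div_Gamma_le {l r : ℝ} (hl : 0 < l) (hlr : l ≤ r) (k : ℕ) :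
    (ascPochhammer ℝ k).eval l / Gamma (r + 2 * k) ≤ 1 / Gamma r := by
  have hr : 0 < r := hl.trans_le hlr
  have hG : 0 < Gamma r := Real.Gamma_pos_of_pos hr
  have h1 : (ascPochhammer ℝ k).eval l ≤ 2 ^ k * (ascPochhammer ℝ k).eval (r / 2) := by
    induction k with
    | zero => simp
    | succ k ih =>
      have := ascPochhammer_eval_pos (x := r / 2) (by positivity) k
      have hk : (0 : ℝ) ≤ k := by positivity
      rw [ascPochhammer_succ_eval, ascPochhammer_succ_eval, pow_succ]
      calc _ ≤ (2 ^ k * (ascPochhammer ℝ k).eval (r / 2)) * (2 * (r / 2 + k)) := by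
            gcongr
            linarith
        _ = _ := by ring
  have h2 : 1 ≤ 2 ^ k * (ascPochhammer ℝ k).eval ((r + 1) / 2) := by
    clear h1
    induction k with
    | zero => simp
    | succ k ih =>
      have hk : (0 : ℝ) ≤ k := by positivity
      rw [ascPochhammer_succ_eval, pow_succ]
      calc 1 ≤ (2 ^ k * (ascPochhammer ℝ k).eval ((r + 1) / 2)) * (2 * ((r + 1) / 2 + k)) :=
            one_le_mul_of_one_le_of_one_le ih (by linarith)
        _ = _ := by ring
  have p0 := ascPochhammer_eval_pos hl k
  have p1 := ascPochhammer_eval_pos (x := r / 2) (by positivity) k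
  have p2 := ascPochhammer_eval_pos (x := (r + 1) / 2) (by positivity) k
  rw [Gamma_add_two_mul hr, div_le_div_iff₀ (by positivity) hG, one_mul]
  refine mul_le_mul_of_nonneg_right ?_ hG.le
  calc _ ≤ 2 ^ k * (ascPochhammer ℝ k).eval (r / 2) := h1
    _ ≤ 2 ^ k * (ascPochhammer ℝ k).eval (r / 2) *
        (2 ^ k * (ascPochhammer ℝ k).eval ((r + 1) / 2)) := le_mul_of_one_le_right (by positivity) h2
    _ = _ := by rw [show (4 : ℝ) = 2 * 2 by norm_num, mul_pow]; ring

theorem abs_laplaceSeries_coeff_le {l r x : ℝ} (hl : 0 < l) (hlr : l ≤ r) (hx : 0 < x) (k : ℕ) :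
    (ascPochhammer ℝ k).eval l / (Nat.factorial k : ℝ) * (x ^ (r + 2 * k - 1) / Gamma (r + 2 * k)) ≤
      x ^ (r - 1) / Gamma r * ((x ^ 2) ^ k / (Nat.factorial k : ℝ)) := by
  have e : x ^ (r + 2 * k - 1) = x ^ (r - 1) * (x ^ 2) ^ k := by
    rw [← pow_mul, ← rpow_natCast x (2 * k), ← rpow_add hx]
    congr 1; push_cast; ring
  calc _ = x ^ (r - 1) * ((x ^ 2) ^ k / (Nat.factorial k : ℝ)) *
        ((ascPochhammer ℝ k).eval l / Gamma (r + 2 * k)) := by rw [e]; ring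
    _ ≤ x ^ (r - 1) * ((x ^ 2) ^ k / (Nat.factorial k : ℝ)) * (1 / Gamma r) :=
      mul_le_mul_of_nonneg_left (ascPochhammer_eval_div_Gamma_le hl hlr k) (by positivity)
    _ = _ := by ring

theorem laplaceSeries_coeff_nonneg {l r x : ℝ} (hl : 0 < l) (hlr : l ≤ r) (hx : 0 < x) (k : ℕ) :
    0 ≤ (ascPochhammer ℝ k).eval l / (Nat.factorial k : ℝ) *
      (x ^ (r + 2 * k - 1) / Gamma (r + 2 * k)) := by
  have hr : 0 < r := hl.trans_le hlr
  have h1 := ascPochhammer_eval_pos hl k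
  have h2 : 0 < Gamma (r + 2 * k) := Real.Gamma_pos_of_pos (by positivity)
  positivity

theorem summable_laplaceSeries_coeff {l r x : ℝ} (hl : 0 < l) (hlr : l ≤ r) (hx : 0 < x) :
    Summable fun k : ℕ => (ascPochhammer ℝ k).eval l / (Nat.factorial k : ℝ) *
      (x ^ (r + 2 * k - 1) / Gamma (r + 2 * k)) :=
  Summable.of_nonneg_of_le (laplaceSeries_coeff_nonneg hl hlr hx)
    (abs_laplaceSeries_coeff_le hl hlr hx) ((Real.summable_pow_div_factorial _).mul_left _)

theorem laplaceSeries_one_three (x : ℝ) : laplaceSeries 1 3 x = 1 - cos x := by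
  have h := (hasSum_nat_add_iff' 1).mpr (Real.hasSum_cos x)
  have h2 := h.neg
  simp only [Finset.range_one, Finset.sum_singleton, pow_zero, mul_zero, Nat.factorial_zero,
    Nat.cast_one, mul_one, div_one, neg_sub] at h2
  rw [laplaceSeries, ← h2.tsum_eq]
  refine tsum_congr fun k => ?_
  have e1 : (3 : ℝ) + 2 * k = ((2 * (k + 1) : ℕ) : ℝ) + 1 := by push_cast; ring
  rw [e1, add_sub_cancel_right, rpow_natCast, Real.Gamma_nat_eq_factorial, ascPochhammer_eval_one,
    div_self (by positivity), pow_succ]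
  ring

theorem integrableOn_and_integral_sub_rpow_mul_rpow {p q x : ℝ} (hp : 0 < p) (hq : 0 < q)
    (hx : 0 < x) :
    IntegrableOn (fun t : ℝ => (x - t) ^ (p - 1) * t ^ (q - 1)) (Ioo 0 x) ∧
    ∫ t in Ioo 0 x, (x - t) ^ (p - 1) * t ^ (q - 1) =
      x ^ (q + p - 1) * (Gamma q * Gamma p / Gamma (q + p)) := by
  have himg : (fun t => x * t) '' Ioo 0 1 = Ioo 0 x := by
    rw [image_mul_left_Ioo hx, mul_zero, mul_one]
  have hderiv : ∀ t ∈ Ioo (0 : ℝ) 1, HasDerivWithinAt (fun t => x * t) x (Ioo 0 1) t := by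
    intro t _
    simpa using ((hasDerivAt_id t).const_mul x).hasDerivWithinAt (s := Ioo 0 1)
  have hinj : InjOn (fun t => x * t) (Ioo 0 1) := fun s _ t _ h => mul_left_cancel₀ hx.ne' h
  have hcongr : ∀ t ∈ Ioo (0 : ℝ) 1, |x| • ((x - x * t) ^ (p - 1) * (x * t) ^ (q - 1)) =
      x ^ (q + p - 1) * (t ^ (q - 1) * (1 - t) ^ (p - 1)) := by
    intro t ht
    rw [show x - x * t = x * (1 - t) by ring, mul_rpow hx.le (by linarith [ht.2]),
      mul_rpow hx.le ht.1.le, abs_of_pos hx, smul_eq_mul,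
      show q + p - 1 = 1 + (p - 1) + (q - 1) by ring, rpow_add hx, rpow_add hx, rpow_one]
    ring
  rw [← himg, integrableOn_image_iff_integrableOn_abs_deriv_smul measurableSet_Ioo hderiv hinj,
    integral_image_eq_integral_abs_deriv_smul measurableSet_Ioo hderiv hinj,
    integrableOn_congr_fun hcongr measurableSet_Ioo,
    setIntegral_congr_fun measurableSet_Ioo hcongr, integral_const_mul, integral_beta hq hp]
  exact ⟨(integrableOn_beta hq hp).const_mul _, rfl⟩

/-- Termwise integration of `laplaceSeries`. -/
theorem hasSum_integral_mul_laplaceSeries {l r : ℝ} (hl : 0 < l) (hlr : l ≤ r) {x : ℝ}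
    {g : ℝ → ℝ} (hg : ∀ t ∈ Ioo 0 x, 0 ≤ g t)
    (hint : ∀ k : ℕ, IntegrableOn (fun t => g t * t ^ (r + 2 * k - 1)) (Ioo 0 x))
    (hsum : Summable fun k : ℕ => (ascPochhammer ℝ k).eval l / (Nat.factorial k : ℝ) *
      ((∫ t in Ioo 0 x, g t * t ^ (r + 2 * k - 1)) / Gamma (r + 2 * k))) :
    HasSum (fun k : ℕ => (-1) ^ k * ((ascPochhammer ℝ k).eval l / (Nat.factorial k : ℝ)) *
      ((∫ t in Ioo 0 x, g t * t ^ (r + 2 * k - 1)) / Gamma (r + 2 * k)))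
      (∫ t in Ioo 0 x, g t * laplaceSeries l r t) := by
  have hr : 0 < r := hl.trans_le hlr
  have key := hasSum_integral_of_summable_integral_norm (μ := volume.restrict (Ioo 0 x))
    (F := fun (k : ℕ) t => (-1) ^ k * ((ascPochhammer ℝ k).eval l / (Nat.factorial k : ℝ)) /
      Gamma (r + 2 * k) * (g t * t ^ (r + 2 * k - 1))) (fun k => (hint k).const_mul _) ?_
  · refine (congrArg₂ (fun F S => HasSum F S) (funext fun k => ?_) ?_).mpr key
    · rw [integral_const_mul]
      ring
    · refine setIntegral_congr_fun measurableSet_Ioo fun t ht => ?_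
      simp only [laplaceSeries]
      rw [← tsum_mul_left]
      refine tsum_congr fun k => ?_
      ring
  · refine hsum.congr fun k => ?_
    have h1 := ascPochhammer_eval_pos hl k
    have h2 : 0 < Gamma (r + 2 * k) := Real.Gamma_pos_of_pos (by positivity)
    rw [mul_div_left_comm, mul_comm, ← integral_const_mul]
    refine setIntegral_congr_fun measurableSet_Ioo fun t ht => ?_
    have h3 := hg t ht
    have h4 : 0 ≤ t ^ (r + 2 * k - 1) := rpow_nonneg ht.1.le _
    simp only [norm_mul, norm_div, norm_pow, norm_neg, norm_one, one_pow, one_mul, norm_eq_abs,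
      Nat.abs_cast, abs_of_pos h1, abs_of_pos h2, abs_of_nonneg h3, abs_of_nonneg h4]

/-- Fractional integration: convolving with `x ^ (p - 1)` multiplies the Laplace transform by `Γ(p)
* s ^ (-p)`. -/
theorem integral_sub_rpow_mul_laplaceSeries {l r p x : ℝ} (hl : 0 < l) (hlr : l ≤ r) (hp : 0 < p)
    (hx : 0 < x) :
    ∫ t in Ioo 0 x, (x - t) ^ (p - 1) * laplaceSeries l r t =
      Gamma p * laplaceSeries l (r + p) x := by
  have hr : 0 < r := hl.trans_le hlr
  have hGp : 0 < Gamma p := Real.Gamma_pos_of_pos hp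
  have hmom := fun k : ℕ => integrableOn_and_integral_sub_rpow_mul_rpow (q := r + 2 * k) hp
    (by positivity) hx
  have hterm : ∀ k : ℕ, (∫ t in Ioo 0 x, (x - t) ^ (p - 1) * t ^ (r + 2 * k - 1)) /
      Gamma (r + 2 * k) = Gamma p * (x ^ (r + p + 2 * k - 1) / Gamma (r + p + 2 * k)) := by
    intro k
    have h2 : 0 < Gamma (r + 2 * k) := Real.Gamma_pos_of_pos (by positivity)
    rw [(hmom k).2, show r + 2 * (k : ℝ) + p = r + p + 2 * k by ring]
    field_simp
  have key := hasSum_integral_mul_laplaceSeries hl hlr (g := fun t => (x - t) ^ (p - 1))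
    (fun t ht => rpow_nonneg (by linarith [ht.2]) _) (fun k => (hmom k).1) (by
      simp_rw [hterm, mul_left_comm _ (Gamma p)]
      exact (summable_laplaceSeries_coeff hl (by linarith) hx).mul_left _)
  rw [← key.tsum_eq, laplaceSeries, ← tsum_mul_left]
  refine tsum_congr fun k => ?_
  rw [hterm]
  ring

/-- Partial sums of the coefficients of `(1 - t) ^ (-l)` are the coefficients of `(1 - t) ^ (-l -
1)`; this is how a convolution raises `l` by one. -/
theorem sum_ascPochhammer_eval_div_factorial (l : ℝ) (n : ℕ) :
    ∑ k ∈ Finset.range (n + 1), (ascPochhammer ℝ k).eval l / (Nat.factorial k : ℝ) =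
      (ascPochhammer ℝ n).eval (l + 1) / (Nat.factorial n : ℝ) := by
  induction n with
  | zero => simp
  | succ n ih =>
    have h : (ascPochhammer ℝ (n + 1)).eval l = l * (ascPochhammer ℝ n).eval (l + 1) := by
      rw [ascPochhammer_succ_left]; simp [Polynomial.eval_comp]
    rw [Finset.sum_range_succ, ih, h, ascPochhammer_succ_eval, Nat.factorial_succ]
    push_cast
    have : (0 : ℝ) < Nat.factorial n := by positivity
    field_simp
    ring

theorem integral_one_sub_cos_mul_rpow {q x : ℝ} (hq : 0 < q) (hx : 0 < x) :
    IntegrableOn (fun t : ℝ => (1 - cos (x - t)) * t ^ (q - 1)) (Ioo 0 x) ∧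
    ∫ t in Ioo 0 x, (1 - cos (x - t)) * t ^ (q - 1) = Gamma q * laplaceSeries 1 (3 + q) x := by
  constructor
  · have h := (integrableOn_and_integral_sub_rpow_mul_rpow one_pos hq hx).1
    simp only [sub_self, rpow_zero, one_mul] at h
    refine h.bdd_mul (c := 2) (by fun_prop) (ae_of_all _ fun t => ?_)
    rw [norm_eq_abs, abs_le]
    constructor <;> linarith [neg_one_le_cos (x - t), cos_le_one (x - t)]
  · rw [← integral_sub_rpow_mul_laplaceSeries one_pos (by norm_num) hq hx,
      ← integral_Ioc_eq_integral_Ioo, ← integral_Ioc_eq_integral_Ioo,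
      ← intervalIntegral.integral_of_le hx.le, ← intervalIntegral.integral_of_le hx.le]
    have h := intervalIntegral.integral_comp_sub_left (a := 0) (b := x)
      (fun t => (x - t) ^ (q - 1) * (1 - cos t)) x
    simp only [sub_sub_cancel, sub_zero, sub_self] at h
    calc _ = ∫ t in (0 : ℝ)..x, t ^ (q - 1) * (1 - cos (x - t)) := by simp_rw [mul_comm]
      _ = _ := h
      _ = _ := by
        rw [intervalIntegral.integral_of_le hx.le, intervalIntegral.integral_of_le hx.le]
        refine setIntegral_congr_fun measurableSet_Ioc fun t ht => ?_
        simp only [laplaceSeries_one_three]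

/-- Regrouping a double series along antidiagonals. -/
theorem tsum_tsum_mul_add {c : ℕ → ℝ} {G : ℕ → ℝ} (hc : ∀ k, 0 ≤ c k) (hG : ∀ n, 0 ≤ G n)
    (h : Summable fun n => (∑ k ∈ Finset.range (n + 1), c k) * G n) :
    (Summable fun k => c k * ∑' j, G (k + j)) ∧
    ∑' k, (-1) ^ k * c k * ∑' j, (-1) ^ j * G (k + j) =
      ∑' n, (-1) ^ n * (∑ k ∈ Finset.range (n + 1), c k) * G n := by
  have hsum : ∀ (σ : ℕ → ℝ) (n : ℕ), ∑ p ∈ Finset.HasAntidiagonal.antidiagonal n,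
      σ (p.1 + p.2) * c p.1 * G (p.1 + p.2) =
      σ n * (∑ k ∈ Finset.range (n + 1), c k) * G n := by
    intro σ n
    rw [Finset.Nat.sum_antidiagonal_eq_sum_range_succ_mk, Finset.mul_sum, Finset.sum_mul]
    refine Finset.sum_congr rfl fun k hk => ?_
    have : k + (n - k) = n := by have := Finset.mem_range.mp hk; omega
    simp only [this]
  have hS : Summable fun p : ℕ × ℕ => c p.1 * G (p.1 + p.2) := by
    rw [← Finset.HasAntidiagonal.sigmaAntidiagonalEquivProd.summable_iff]
    refine (summable_sigma_of_nonneg fun p => mul_nonneg (hc _) (hG _)).mpr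
      ⟨fun n => Summable.of_finite, ?_⟩
    refine h.congr fun n => ?_
    rw [tsum_fintype]
    have h1 := hsum (fun _ => 1) n
    simp only [one_mul] at h1
    rw [← h1, ← Finset.sum_coe_sort]
    rfl
  have hS' : Summable fun p : ℕ × ℕ => (-1 : ℝ) ^ (p.1 + p.2) * c p.1 * G (p.1 + p.2) := by
    refine Summable.of_norm_bounded hS fun p => ?_
    rw [norm_mul, norm_mul, norm_pow, norm_neg, norm_one, one_pow, one_mul, norm_eq_abs,
      norm_eq_abs, abs_of_nonneg (hc _), abs_of_nonneg (hG _)]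
  constructor
  · have := hS.prod
    simpa only [tsum_mul_left] using this
  · calc _ = ∑' k, ∑' j, (-1) ^ (k + j) * c k * G (k + j) := by
          refine tsum_congr fun k => ?_
          rw [← tsum_mul_left]
          refine tsum_congr fun j => ?_
          rw [pow_add]; ring
      _ = ∑' p : ℕ × ℕ, (-1 : ℝ) ^ (p.1 + p.2) * c p.1 * G (p.1 + p.2) := hS'.tsum_prod.symm
      _ = _ := by
          rw [← Finset.HasAntidiagonal.sigmaAntidiagonalEquivProd.tsum_eq]
          refine (Summable.tsum_sigma
            (Finset.HasAntidiagonal.sigmaAntidiagonalEquivProd.summable_iff.mpr hS')).trans ?_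
          refine tsum_congr fun n => ?_
          rw [tsum_fintype, ← hsum (fun n => (-1) ^ n) n]
          exact Finset.sum_coe_sort _ fun p : ℕ × ℕ => (-1 : ℝ) ^ (p.1 + p.2) * c p.1 * G (p.1 + p.2)

/-- The transform of `1 - cos` is `1 / (s * (1 + s ^ 2))`, hence the shift by `(1, 3)`. On series,
each power convolved with `1 - cos` is again a series; regrouping the double sum along antidiagonals
produces the partial sums above. -/
theorem integral_one_sub_cos_mul_laplaceSeries {l r x : ℝ} (hl : 0 < l) (hlr : l ≤ r)
    (hx : 0 < x) :
    ∫ t in Ioo 0 x, (1 - cos (x - t)) * laplaceSeries l r t = laplaceSeries (l + 1) (r + 3) x := by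
  have hr : 0 < r := hl.trans_le hlr
  set c : ℕ → ℝ := fun k => (ascPochhammer ℝ k).eval l / (Nat.factorial k : ℝ) with hc
  set G : ℕ → ℝ := fun n => x ^ (r + 3 + 2 * n - 1) / Gamma (r + 3 + 2 * n) with hG
  have hcn : ∀ k, 0 ≤ c k := fun k => div_nonneg (ascPochhammer_eval_pos hl k).le (by positivity)
  have hGn : ∀ k, 0 ≤ G k := fun k =>
    div_nonneg (by positivity) (Real.Gamma_pos_of_pos (by positivity)).le
  have hsumm : Summable fun n => (∑ k ∈ Finset.range (n + 1), c k) * G n := by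
    simp_rw [hc, sum_ascPochhammer_eval_div_factorial]
    exact summable_laplaceSeries_coeff (by linarith) (by linarith) hx
  have hdouble := tsum_tsum_mul_add hcn hGn hsumm
  have hmom := fun k : ℕ => integral_one_sub_cos_mul_rpow (q := r + 2 * k) (by positivity) hx
  have hshift : ∀ k j : ℕ, x ^ (3 + (r + 2 * k) + 2 * j - 1) / Gamma (3 + (r + 2 * k) + 2 * j) =
      G (k + j) := by
    intro k j
    simp only [hG]
    rw [show (3 + (r + 2 * k) + 2 * j : ℝ) = r + 3 + 2 * ((k + j : ℕ) : ℝ) by push_cast; ring]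
  have hterm : ∀ k : ℕ, (∫ t in Ioo 0 x, (1 - cos (x - t)) * t ^ (r + 2 * k - 1)) /
      Gamma (r + 2 * k) = ∑' j, (-1) ^ j * G (k + j) := by
    intro k
    have h2 : 0 < Gamma (r + 2 * k) := Real.Gamma_pos_of_pos (by positivity)
    rw [(hmom k).2, mul_div_cancel_left₀ _ h2.ne', laplaceSeries]
    refine tsum_congr fun j => ?_
    rw [hshift, ascPochhammer_eval_one, div_self (by positivity), mul_one]
  have hnn : ∀ k : ℕ, 0 ≤ (∫ t in Ioo 0 x, (1 - cos (x - t)) * t ^ (r + 2 * k - 1)) /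
      Gamma (r + 2 * k) := fun k => div_nonneg
    (setIntegral_nonneg measurableSet_Ioo fun t ht =>
      mul_nonneg (by linarith [cos_le_one (x - t)]) (rpow_nonneg ht.1.le _))
    (Real.Gamma_pos_of_pos (by positivity)).le
  have hGs : ∀ k, Summable fun j => G (k + j) := by
    intro k
    have h := summable_laplaceSeries_coeff (l := 1) (r := 3 + (r + 2 * k)) one_pos
      (by linarith [show (0 : ℝ) ≤ k by positivity]) hx
    refine h.congr fun j => ?_
    rw [hshift, ascPochhammer_eval_one, div_self (by positivity), one_mul]
  have key := hasSum_integral_mul_laplaceSeries hl hlr (g := fun t => 1 - cos (x - t))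
    (fun t _ => by linarith [cos_le_one (x - t)]) (fun k => (hmom k).1) (by
      -- Each alternating inner sum is at most the unsigned one, for which the double series
      -- converges.
      refine Summable.of_nonneg_of_le (fun k => mul_nonneg (hcn k) (hnn k)) (fun k => ?_) hdouble.1
      refine mul_le_mul_of_nonneg_left ?_ (hcn k)
      rw [hterm]
      refine Summable.tsum_le_tsum (fun j => ?_) ?_ (hGs k)
      · refine (le_abs_self _).trans ?_
        rw [abs_mul, abs_pow, abs_neg, abs_one, one_pow, one_mul, abs_of_nonneg (hGn _)]
      · refine Summable.of_norm_bounded (hGs k) fun j => ?_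
        rw [norm_mul, norm_pow, norm_neg, norm_one, one_pow, one_mul, norm_eq_abs,
          abs_of_nonneg (hGn _)])
  rw [← key.tsum_eq]
  simp_rw [hterm]
  rw [hdouble.2, laplaceSeries]
  simp_rw [hc, sum_ascPochhammer_eval_div_factorial]
  rfl

theorem laplaceSeries_eq_hypergeometric1F2 {l r x : ℝ} (hr : 0 < r) (hx : 0 < x) :
    laplaceSeries l r x =
      x ^ (r - 1) / Gamma r * hypergeometric1F2 l (r / 2) ((r + 1) / 2) (-x ^ 2 / 4) := by
  rw [laplaceSeries, hypergeometric1F2, ← tsum_mul_left]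
  refine tsum_congr fun k => ?_
  have e : x ^ (r + 2 * k - 1) = x ^ (r - 1) * (x ^ 2) ^ k := by
    rw [← pow_mul, ← rpow_natCast x (2 * k), ← rpow_add hx]
    congr 1; push_cast; ring
  have p1 := ascPochhammer_eval_pos (x := r / 2) (by positivity) k
  have p2 := ascPochhammer_eval_pos (x := (r + 1) / 2) (by positivity) k
  have p3 : 0 < Gamma r := Real.Gamma_pos_of_pos hr
  rw [e, Gamma_add_two_mul hr, neg_div, neg_pow (x ^ 2 / 4), div_pow]
  generalize (ascPochhammer ℝ k).eval (r / 2) = q1 at *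
  generalize (ascPochhammer ℝ k).eval ((r + 1) / 2) = q2 at *
  field_simp

/-- At `r = 2 * l` the power of `s` disappears from the transform and the series is a Bessel
function of order `l - 1/2`; for `0 < l < 1` this order lies in the range of
`exists_abs_besselSeries_le_rpow`. -/
theorem laplaceSeries_two_mul {l x : ℝ} (hl : 0 < l) (hx : 0 < x) :
    laplaceSeries l (2 * l) x =
      Gamma (l + 1 / 2) / Gamma (2 * l) * x ^ (2 * l - 1) * besselSeries (l - 1 / 2) x := by
  rw [laplaceSeries, besselSeries, ← tsum_mul_left]
  refine tsum_congr fun k => ?_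
  have e : x ^ (2 * l + 2 * k - 1) = x ^ (2 * l - 1) * (x ^ 2) ^ k := by
    rw [← pow_mul, ← rpow_natCast x (2 * k), ← rpow_add hx]
    congr 1; push_cast; ring
  have g := ascPochhammer_eval_mul_Gamma (x := l + 1 / 2) (by positivity) k
  rw [e, Gamma_add_two_mul (by positivity), show 2 * l / 2 = l by ring,
    show (2 * l + 1) / 2 = l + 1 / 2 by ring, pow_mul (x / 2), div_pow, div_pow,
    show (k : ℝ) + (l - 1 / 2) + 1 = l + 1 / 2 + k by ring, ← g]
  have p1 := ascPochhammer_eval_pos hl k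
  have p2 := ascPochhammer_eval_pos (x := l + 1 / 2) (by positivity) k
  have p3 : 0 < Gamma (2 * l) := Real.Gamma_pos_of_pos (by positivity)
  have p4 : 0 < Gamma (l + 1 / 2) := Real.Gamma_pos_of_pos (by positivity)
  generalize (ascPochhammer ℝ k).eval (l + 1 / 2) = q1 at *
  generalize Gamma (l + 1 / 2) = q2 at *
  norm_num
  field_simp

theorem exists_abs_laplaceSeries_add_le {l r p q C : ℝ} (hl : 0 < l) (hlr : l ≤ r) (hp : -1 < p)
    (hq : 0 < q) (hC : ∀ x, 0 < x → |laplaceSeries l r x| ≤ C * x ^ p) :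
    ∃ C', ∀ x, 0 < x → |laplaceSeries l (r + q) x| ≤ C' * x ^ (p + q) := by
  have hG : 0 < Gamma q := Real.Gamma_pos_of_pos hq
  refine ⟨1 / Gamma q * (C * (Gamma (p + 1) * Gamma q / Gamma (p + 1 + q))), fun x hx => ?_⟩
  have h := integral_sub_rpow_mul_laplaceSeries hl hlr hq hx
  have hb := integrableOn_and_integral_sub_rpow_mul_rpow (p := q) (q := p + 1) hq (by linarith) hx
  rw [show p + 1 + q - 1 = p + q by ring, add_sub_cancel_right] at hb
  have hle : |Gamma q * laplaceSeries l (r + q) x| ≤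
      C * ∫ t in Ioo 0 x, (x - t) ^ (q - 1) * t ^ p := by
    rw [← h, ← norm_eq_abs, ← integral_const_mul]
    refine norm_integral_le_of_norm_le (hb.1.const_mul C) ?_
    filter_upwards [ae_restrict_mem measurableSet_Ioo] with t ht
    have h0 : 0 ≤ (x - t) ^ (q - 1) := rpow_nonneg (by linarith [ht.2]) _
    rw [norm_mul, norm_eq_abs, norm_eq_abs, abs_of_nonneg h0, mul_left_comm]
    exact mul_le_mul_of_nonneg_left (hC t ht.1) h0
  rw [hb.2, abs_mul, abs_of_pos hG] at hle
  rw [mul_assoc, one_div, ← div_eq_inv_mul, le_div_iff₀ hG]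
  linarith

theorem exists_abs_laplaceSeries_add_one_le {l r p C : ℝ} (hl : 0 < l) (hlr : l ≤ r) (hp : -1 < p)
    (hC : ∀ x, 0 < x → |laplaceSeries l r x| ≤ C * x ^ p) :
    ∃ C', ∀ x, 0 < x → |laplaceSeries (l + 1) (r + 3) x| ≤ C' * x ^ (p + 1) := by
  refine ⟨2 * C * (Gamma (p + 1) * Gamma 1 / Gamma (p + 1 + 1)), fun x hx => ?_⟩
  have hb := integrableOn_and_integral_sub_rpow_mul_rpow (p := 1) (q := p + 1) one_pos
    (by linarith) hx
  simp only [add_sub_cancel_right, sub_self, rpow_zero, one_mul] at hb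
  rw [← integral_one_sub_cos_mul_laplaceSeries hl hlr hx, mul_assoc, mul_comm (_ / _), ← hb.2,
    ← norm_eq_abs, ← integral_const_mul]
  refine norm_integral_le_of_norm_le (hb.1.const_mul _) ?_
  filter_upwards [ae_restrict_mem measurableSet_Ioo] with t ht
  have h1 : |1 - cos (x - t)| ≤ 2 := by
    rw [abs_le]
    constructor <;> linarith [neg_one_le_cos (x - t), cos_le_one (x - t)]
  rw [norm_mul, norm_eq_abs, norm_eq_abs, mul_assoc]
  exact mul_le_mul h1 (hC t ht.1) (abs_nonneg _) zero_le_two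

/-- For `l = 1`, start from the bounded function `1 - cos` and integrate to order `μ - 1`, so `ε =
1`. For `l < 1`, start from the Bessel case, of size `x ^ (l - 1)`, and integrate to order `μ`, so
`ε = 1 - l`. -/
theorem exists_abs_laplaceSeries_le_of_le_one {l μ : ℝ} (hl : 0 < l) (hl1 : l ≤ 1) (hμ : l ≤ μ) :
    ∃ ε C, 0 < ε ∧ ε ≤ 1 ∧ ∀ x, 0 < x → |laplaceSeries l (2 * l + μ) x| ≤ C * x ^ (μ - ε) := by
  rcases hl1.eq_or_lt with rfl | hl1
  · have h1 : ∀ x, 0 < x → |laplaceSeries 1 3 x| ≤ 2 * x ^ (0 : ℝ) := by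
      intro x _
      rw [laplaceSeries_one_three, rpow_zero, mul_one, abs_le]
      constructor <;> linarith [neg_one_le_cos x, cos_le_one x]
    rcases hμ.eq_or_lt with rfl | hμ
    · refine ⟨1, 2, one_pos, le_rfl, fun x hx => ?_⟩
      rw [sub_self, show (2 * 1 + 1 : ℝ) = 3 by norm_num]
      exact h1 x hx
    · obtain ⟨C, hC⟩ := exists_abs_laplaceSeries_add_le one_pos (by norm_num) (by norm_num)
        (sub_pos.mpr hμ) h1
      refine ⟨1, C, one_pos, le_rfl, fun x hx => ?_⟩
      have := hC x hx
      rwa [zero_add, show 3 + (μ - 1) = 2 * 1 + μ by ring] at this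
  · obtain ⟨C, -, hC⟩ := exists_abs_besselSeries_le_rpow (a := l - 1 / 2) (by linarith) (by linarith)
    have h1 : ∀ x, 0 < x → |laplaceSeries l (2 * l) x| ≤
        Gamma (l + 1 / 2) / Gamma (2 * l) * C * x ^ (l - 1) := by
      intro x hx
      have p1 : 0 < Gamma (2 * l) := Real.Gamma_pos_of_pos (by positivity)
      have p2 : 0 < Gamma (l + 1 / 2) := Real.Gamma_pos_of_pos (by positivity)
      have p3 : 0 < Gamma (l + 1 / 2) / Gamma (2 * l) * x ^ (2 * l - 1) := by positivity
      rw [laplaceSeries_two_mul hl hx, abs_mul, abs_of_pos p3]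
      refine (mul_le_mul_of_nonneg_left (hC x hx) p3.le).trans (le_of_eq ?_)
      rw [show l - 1 = (2 * l - 1) + -(l - 1 / 2 + 1 / 2) by ring, rpow_add hx]
      ring
    obtain ⟨C', hC'⟩ := exists_abs_laplaceSeries_add_le hl (by linarith) (by linarith)
      (hl.trans_le hμ) h1
    refine ⟨1 - l, C', by linarith, by linarith, fun x hx => ?_⟩
    have := hC' x hx
    rwa [show l - 1 + μ = μ - (1 - l) by ring] at this

theorem exists_abs_laplaceSeries_le {l μ : ℝ} (hl : 0 < l) (hμ : l ≤ μ) :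
    ∃ ε C, 0 < ε ∧ ε ≤ 1 ∧ ∀ x, 0 < x → |laplaceSeries l (2 * l + μ) x| ≤ C * x ^ (μ - ε) := by
  obtain ⟨n, hn⟩ := exists_nat_ge l
  induction n generalizing l μ with
  | zero => exact absurd hn (by push_cast; linarith)
  | succ n ih =>
    rcases le_or_gt l 1 with hl1 | hl1
    · exact exists_abs_laplaceSeries_le_of_le_one hl hl1 hμ
    -- Lowering both parameters preserves `l ≤ μ`. The bound `ε ≤ 1` keeps the exponent `μ - 1 - ε`
    -- above `-1`, so the convolution with `1 - cos` converges.
    · obtain ⟨ε, C, hε, hε1, hC⟩ := ih (l := l - 1) (μ := μ - 1) (by linarith) (by linarith)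
        (by push_cast at hn; linarith)
      obtain ⟨C', hC'⟩ := exists_abs_laplaceSeries_add_one_le (by linarith) (by linarith)
        (by linarith) hC
      refine ⟨ε, C', hε, hε1, fun x hx => ?_⟩
      have := hC' x hx
      rwa [sub_add_cancel, show 2 * (l - 1) + (μ - 1) + 3 = 2 * l + μ by ring,
        show μ - 1 - ε + 1 = μ - ε by ring] at this

/-! ### Decay and integrability of the Wendland spectral density. -/

theorem measurable_generalizedWendlandSpectral (d : ℕ) {ν μ : ℝ} (hν : 0 ≤ ν) (hμ : 1 ≤ μ) (δ : ℝ) :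
    Measurable (generalizedWendlandSpectral d ν μ δ) := by
  have hL : 1 / 2 ≤ wendlandLambda d ν := by
    rw [wendlandLambda]
    linarith [show (0 : ℝ) ≤ d by positivity]
  have h : Measurable (hypergeometric1F2 (wendlandLambda d ν) (wendlandLambda d ν + μ / 2)
      (wendlandLambda d ν + (μ + 1) / 2)) := by
    refine measurable_of_tendsto_metrizable (f := fun (n : ℕ) x => ∑ k ∈ Finset.range n,
      (ascPochhammer ℝ k).eval (wendlandLambda d ν) /
      ((ascPochhammer ℝ k).eval (wendlandLambda d ν + μ / 2) *
        (ascPochhammer ℝ k).eval (wendlandLambda d ν + (μ + 1) / 2)) *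
        (x ^ k / (Nat.factorial k : ℝ))) ?_ ?_
    · intro n; fun_prop
    · rw [tendsto_pi_nhds]
      exact fun x => (summable_hypergeometric1F2 (by linarith) (by linarith) (by linarith)
        x).hasSum.tendsto_sum_nat
  unfold generalizedWendlandSpectral
  exact (h.comp (by fun_prop)).const_mul _

theorem exists_abs_generalizedWendlandSpectral_le (d : ℕ) {ν μ δ : ℝ} (hν : 0 ≤ ν)
    (hμ : wendlandLambda d ν ≤ μ) (hδ : 0 < δ) :
    ∃ ε C, 0 < ε ∧
      ∀ z, 0 < z → |generalizedWendlandSpectral d ν μ δ z| ≤ C * z ^ (-(d : ℝ) - ε) := by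
  set L : ℝ := wendlandLambda d ν with hL
  have hLd : L = ((d : ℝ) + 1) / 2 + ν := by rw [hL, wendlandLambda]
  have hL0 : 0 < L := by rw [hLd]; positivity
  obtain ⟨ε, C, hε, -, hC⟩ := exists_abs_laplaceSeries_le hL0 hμ
  have hr : 0 < 2 * L + μ := by linarith
  have hG : 0 < Gamma (2 * L + μ) := Real.Gamma_pos_of_pos hr
  set A : ℝ := 2 ^ (-(d : ℝ)) * π ^ (-(d : ℝ) / 2) * Gamma (μ + 2 * ν + 1) * Gamma (2 * ν + d) *
    gammaRatio ν / (Gamma (ν + d / 2) * Gamma (μ + 2 * ν + d + 1)) * δ ^ d with hA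
  -- Dividing the growth `x ^ (μ - ε)` by the prefactor `x ^ (2 * L + μ - 1)` leaves `1 - 2 * L - ε
  -- = -d - (2 * ν + ε)`.
  refine ⟨2 * ν + ε, |A| * (Gamma (2 * L + μ) * C * δ ^ (-(d : ℝ) - (2 * ν + ε))), by positivity,
    fun z hz => ?_⟩
  have hx : 0 < z * δ := by positivity
  have h := hC (z * δ) hx
  rw [laplaceSeries_eq_hypergeometric1F2 hr hx, show (2 * L + μ) / 2 = L + μ / 2 by ring,
    show (2 * L + μ + 1) / 2 = L + (μ + 1) / 2 by ring, abs_mul,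
    abs_of_pos (by positivity)] at h
  rw [generalizedWendlandSpectral, ← hA, ← hL, abs_mul, mul_assoc |A|]
  refine mul_le_mul_of_nonneg_left ?_ (abs_nonneg _)
  have e : (z * δ) ^ (μ - ε) =
      (z * δ) ^ (2 * L + μ - 1) * (z ^ (-(d : ℝ) - (2 * ν + ε)) * δ ^ (-(d : ℝ) - (2 * ν + ε))) := by
    rw [← mul_rpow hz.le hδ.le, ← rpow_add hx]
    congr 1
    rw [hLd]; ring
  have hp : 0 < (z * δ) ^ (2 * L + μ - 1) := by positivity
  rw [e, div_mul_eq_mul_div, div_le_iff₀ hG] at h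
  refine le_of_mul_le_mul_left (h.trans (le_of_eq ?_)) hp
  ring

theorem integrableOn_pow_mul_spectralDensity_wendlandProfile {d : ℕ} (hd : 1 ≤ d) {ν μ δ : ℝ}
    (hν : 0 ≤ ν) (hμ : wendlandLambda d ν ≤ μ) (hδ : 0 < δ) :
    IntegrableOn (fun z => z ^ (d - 1) *
      spectralDensity d (fun u => wendlandProfile ν μ (u / δ)) z) (Ioi 0) := by
  have hd' : (1 : ℝ) ≤ d := by exact_mod_cast hd
  have hμ1 : 1 ≤ μ := by rw [wendlandLambda] at hμ; linarith
  have hμ0 : 0 < μ := by linarith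
  have hmeas : Measurable fun z => z ^ (d - 1) * generalizedWendlandSpectral d ν μ δ z :=
    Measurable.mul (by fun_prop) (measurable_generalizedWendlandSpectral d hν hμ1 δ)
  have heq : ∀ z ∈ Ioi (0 : ℝ), z ^ (d - 1) *
      spectralDensity d (fun u => wendlandProfile ν μ (u / δ)) z =
      z ^ (d - 1) * generalizedWendlandSpectral d ν μ δ z := by
    intro z hz
    rw [spectralDensity_wendlandProfile hd hν hμ0 hδ hz]
  rw [integrableOn_congr_fun heq measurableSet_Ioi, ← Ioc_union_Ioi_eq_Ioi zero_le_one]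
  refine IntegrableOn.union ?_ ?_
  -- On `(0, 1]` the density is bounded, being the integral of a bounded kernel against an
  -- integrable function.
  · obtain ⟨C, hC0, hC⟩ := exists_abs_besselSeries_le (a := (d : ℝ) / 2 - 1) (by linarith)
    have hi := (integrableOn_and_integral_rpow_mul_wendlandProfile_div (s := d) hν hμ0
      (by positivity) hδ).1
    rw [show (d : ℝ) - 1 = 2 * ((d : ℝ) / 2 - 1) + 1 by ring] at hi
    set M : ℝ := |2 ^ (1 - (d : ℝ)) * π ^ (-(d : ℝ) / 2)| *
      ∫ u in Ioi (0 : ℝ), C * ‖u ^ (2 * ((d : ℝ) / 2 - 1) + 1) * wendlandProfile ν μ (u / δ)‖ with hM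
    refine Measure.integrableOn_of_bounded (M := M) (by simp) hmeas.aestronglyMeasurable ?_
    filter_upwards [ae_restrict_mem measurableSet_Ioc] with z hz
    rw [norm_mul, norm_pow, norm_eq_abs, norm_eq_abs, abs_of_pos hz.1]
    have h1 : |generalizedWendlandSpectral d ν μ δ z| ≤ M := by
      rw [← spectralDensity_wendlandProfile hd hν hμ0 hδ hz.1,
        spectralDensity_eq_integral_besselSeries d _ hz.1, abs_mul, hM]
      refine mul_le_mul_of_nonneg_left ?_ (abs_nonneg _)
      rw [← norm_eq_abs]
      refine norm_integral_le_of_norm_le (hi.norm.const_mul C) (ae_of_all _ fun u => ?_)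
      rw [mul_right_comm, norm_mul, mul_comm]
      exact mul_le_mul_of_nonneg_right (hC _) (norm_nonneg _)
    exact (mul_le_of_le_one_left (abs_nonneg _) (pow_le_one₀ hz.1.le hz.2)).trans h1
  -- Beyond 1 the decay beats `z ^ (-d)` by `z ^ (-ε)`, so `z ^ (-1 - ε)` is a majorant.
  · obtain ⟨ε, C, hε, hC⟩ := exists_abs_generalizedWendlandSpectral_le d hν hμ hδ
    refine Integrable.mono' ((integrableOn_Ioi_rpow_of_lt (a := -1 - ε) (by linarith)
      one_pos).const_mul C) hmeas.aestronglyMeasurable ?_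
    filter_upwards [ae_restrict_mem measurableSet_Ioi] with z hz
    have hz : 0 < z := one_pos.trans hz
    rw [norm_mul, norm_pow, norm_eq_abs, norm_eq_abs, abs_of_pos hz]
    refine (mul_le_mul_of_nonneg_left (hC z hz) (by positivity)).trans (le_of_eq ?_)
    rw [← rpow_natCast, Nat.cast_sub hd, mul_left_comm, ← rpow_add hz]
    congr 2
    push_cast
    ring

/-! ### Assembly of the main theorem. -/

theorem lemma1 (d : ℕ) (hd : 1 ≤ d) (ν μ β : ℝ) (hν : 0 ≤ ν) (hβ : 0 < β)
    (hμ : wendlandLambda d ν ≤ μ) :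
    -- the closed forms of the two spectral densities
    (∀ z : ℝ, 0 < z → spectralDensity d (reparamWendland ν μ β) z =
      generalizedWendlandSpectral d ν μ (wendlandDelta ν μ β) z) ∧
    (∀ z : ℝ, 0 < z → spectralDensity d (matern (ν + 1 / 2) β) z =
      maternSpectral d (ν + 1 / 2) β z) ∧
    -- both integrals converge and have the same value `Γ(d/2) / (2 π^(d/2))`
    IntegrableOn (fun z => z ^ (d - 1) * spectralDensity d (reparamWendland ν μ β) z)
      (Ioi 0) ∧
    IntegrableOn (fun z => z ^ (d - 1) * spectralDensity d (matern (ν + 1 / 2) β) z)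
      (Ioi 0) ∧
    ∫ z in Ioi (0 : ℝ), z ^ (d - 1) * spectralDensity d (reparamWendland ν μ β) z =
      ∫ z in Ioi (0 : ℝ), z ^ (d - 1) * spectralDensity d (matern (ν + 1 / 2) β) z ∧
    ∫ z in Ioi (0 : ℝ), z ^ (d - 1) * spectralDensity d (matern (ν + 1 / 2) β) z =
      Gamma ((d : ℝ) / 2) / (2 * π ^ ((d : ℝ) / 2)) := by
  have hd' : (1 : ℝ) ≤ d := by exact_mod_cast hd
  have hμ0 : 0 < μ := by rw [wendlandLambda] at hμ; linarith
  have hκ : 0 < ν + 1 / 2 := by linarith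
  have hδ : 0 < wendlandDelta ν μ β := by
    have h1 : 0 < Gamma (μ + 2 * ν + 1) := Real.Gamma_pos_of_pos (by positivity)
    have h2 : 0 < Gamma μ := Real.Gamma_pos_of_pos hμ0
    rw [wendlandDelta]
    positivity
  set δ := wendlandDelta ν μ β with hδ_def
  have hprofile : spectralDensity d (reparamWendland ν μ β) =
      spectralDensity d (fun u => wendlandProfile ν μ (u / δ)) :=
    spectralDensity_congr d fun u hu => generalizedWendland_eq_wendlandProfile hν hμ0 hδ hu
  have hMi : IntegrableOn (fun z => z ^ (d - 1) * spectralDensity d (matern (ν + 1 / 2) β) z)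
      (Ioi 0) :=
    (integrableOn_pow_mul_maternSpectral (κ := ν + 1 / 2) hd (by linarith) hβ).congr_fun
      (fun z hz => by rw [spectralDensity_matern hd hκ hβ hz]) measurableSet_Ioi
  have hWi := integrableOn_pow_mul_spectralDensity_wendlandProfile hd hν hμ hδ
  have hMv := integral_pow_mul_spectralDensity hd (measurable_matern _ β)
    (fun u hu => abs_matern_le_one hκ hβ hu) (tendsto_matern hκ hβ)
    (integrableOn_rpow_mul_matern (by linarith) hκ hβ) hMi
  have hWm := (integrableOn_and_integral_rpow_mul_wendlandProfile_div (s := d) hν hμ0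
      (by positivity) hδ).1
  rw [show (d : ℝ) - 1 = 2 * ((d : ℝ) / 2 - 1) + 1 by ring] at hWm
  have hWv := integral_pow_mul_spectralDensity hd (φ := fun u => wendlandProfile ν μ (u / δ))
    ((measurable_wendlandProfile ν μ).comp (measurable_id.div_const δ))
    (fun u hu => abs_le.mpr ⟨by linarith [wendlandProfile_nonneg hν hμ0 (u / δ)],
      wendlandProfile_le_one hν hμ0 (div_pos hu hδ).le⟩)
    (((tendsto_wendlandProfile hν hμ0).comp (by
      simpa using (continuous_id.div_const δ).tendsto 0)).mono_left nhdsWithin_le_nhds) hWm hWi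
  rw [hprofile]
  exact ⟨fun z hz => spectralDensity_wendlandProfile hd hν hμ0 hδ hz,
    fun z hz => spectralDensity_matern hd hκ hβ hz, hWi, hMi, hWv.trans hMv.symm, hMv⟩
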